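/- **Setting.** Let $\mathbb T$ be the unit circle, $\mathbb N=\{1,2,\dots\}$, $\mathbb Z_+=\mathbb N\cup\{0\}$, and for $f\in L^1(\mathbb T)$ let $f_n=\frac1{2\pi}\int_0^{2\pi}f(e^{i\theta})e^{-in\theta}\,d\theta$ $(n\in\mathbb Z)$. An *Orlicz function* is a continuous, non-decreasing, convex function $\Phi$ on $[0,\infty)$ with $\Phi(0)=0$ and $\Phi(t)\to\infty$ as $t\to\infty$. For $\mathbb I\in\{\mathbb N,\mathbb Z_+\}$ and sequences $\varphi=(\varphi_n)_{n\in\mathbb I}$, $w=(w_n)_{n\in\mathbb I}$ of positive numbers, $\ell^\Phi_{\varphi,w}(\mathbb I)$ is the set of complex sequences $c=(c_n)_{n\in\mathbb I}$ with $\sum_{n\in\mathbb I}\Phi(|c_n|\varphi_n/\lambda)\,w_n<\infty$ for some $\lambda>0$, with the norm $$\|c\|_{\ell^\Phi_{\varphi,w}(\mathbb I)}=\inf\Big\{\lambda>0:\ \sum_{n\in\mathbb I}\Phi\big(|c_n|\varphi_n/\lambda\big)\,w_n\le 1\Big\}.$$ Let $\mathcal W^+$ (resp. $\mathcal W^-$)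 be the set of non-decreasing sequences $(\nu_n)_{n\ge0}$ (resp. $(\nu_n)_{n\ge1}$) of positive numbers for which there is a constant $C_\nu\in(0,\infty)$ with $\nu_{2n}\le C_\nu\nu_n$ for all $n\in\mathbb N$. Let $\Phi,\Psi$ be Orlicz functions, $\varphi,w\in\mathcal W^-$ and $\psi,\varrho\in\mathcal W^+$. Let $\mathcal A=W\cap F\ell^{\Phi,\Psi}_{\varphi,w;\psi,\varrho}$ be the set of all $f\in L^1(\mathbb T)$ with $\sum_{n\in\mathbb Z}|f_n|<\infty$, $(f_{-n})_{n\in\mathbb N}\in\ell^\Phi_{\varphi,w}(\mathbb N)$ and $(f_n)_{n\in\mathbb Z_+}\in\ell^\Psi_{\psi,\varrho}(\mathbb Z_+)$, each such $f$ being identified with its continuous representative. For $f\in\mathcal A$ put $$\|f\|_{\mathcal A}=\sum_{n\in\mathbb Z}|f_n|+\big\|(f_{-n})_{n\in\mathbb N}\big\|_{\ell^\Phi_{\varphi,w}(\mathbb N)}+\big\|(f_n)_{n\in\mathbb Z_+}\big\|_{\ell^\Psi_{\psi,\varrho}(\mathbb Z_+)}.$$ **Corollary 2.3.** (a) $\mathcal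 A$ is a unital commutative Banach algebra under pointwise multiplication; that is, $\mathcal A$ is a subalgebra of the algebra of functions on $\mathbb T$ containing the constants, $\|\cdot\|_{\mathcal A}$ is a complete norm on $\mathcal A$, and there is a constant $C>0$ with $\|fg\|_{\mathcal A}\le C\|f\|_{\mathcal A}\|g\|_{\mathcal A}$ for all $f,g\in\mathcal A$. The maximal ideal space of $\mathcal A$ is $\mathbb T$: the map sending $t\in\mathbb T$ to the evaluation $f\mapsto f(t)$ is a homeomorphism of $\mathbb T$ onto the set of all unital algebra homomorphisms $\mathcal A\to\mathbb C$ with the topology of pointwise convergence, and the maximal ideals of $\mathcal A$ are exactly the sets $\{f\in\mathcal A: f(t)=0\}$, each for a unique $t\in\mathbb T$. (b) If $b\in\mathcal A$ does not vanish on $\mathbb T$ and the Cauchy index of $b$ (the winding number of $b$ about the origin) is zero, then $b$ has a logarithm in $\mathcal A$: there is $a\in\mathcal A$ with $e^{a}=b$ on $\mathbb T$. (c) Let $b$ be as in (b) and let $\log b\in\mathcal A$ be any logarithm of $b$. Put $$G(b)=\exp\big((\log b)_0\big),\qquad b_\pm(t)=\exp\Big(\sum_{n=1}^\infty(\log b)_{\pm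 n}\,t^{\pm n}\Big)\quad(t\in\mathbb T),$$ where both series converge absolutely. Then $b=G(b)\,b_-\,b_+$ on $\mathbb T$, and $b_+,\ b_+^{-1},\ b_-,\ b_-^{-1}\in\mathcal A$. -/

import Mathlib

open scoped ENNReal Topology

noncomputable section

namespace OrliczWiener

/-- An Orlicz function: a continuous, non-decreasing, convex function on `[0, ∞)` with
`Φ 0 = 0` and `Φ t → ∞` as `t → ∞`. Only the values on `[0, ∞)` matter. -/
structure IsOrliczFunction (Φ : ℝ → ℝ) : Prop where
  continuousOn : ContinuousOn Φ (Set.Ici 0)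
  monotoneOn : MonotoneOn Φ (Set.Ici 0)
  convexOn : ConvexOn ℝ (Set.Ici 0) Φ
  map_zero : Φ 0 = 0
  tendsto_atTop : Filter.Tendsto Φ Filter.atTop Filter.atTop

/-- The class `𝒲⁺`: sequences `(ν₀, ν₁, …)` of positive numbers that are non-decreasing and satisfy
the `Δ₂`-condition `ν_{2n} ≤ C ν_n` for all `n ≥ 1`. -/
structure IsWeightPlus (ν : ℕ → ℝ) : Prop where
  pos : ∀ n, 0 < ν n
  le_succ : ∀ n, ν n ≤ ν (n + 1)
  delta_two : ∃ C : ℝ, 0 < C ∧ ∀ n, 1 ≤ n → ν (2 * n) ≤ C * ν n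

/-- The class `𝒲⁻`: sequences `(ν₁, ν₂, …)` of positive numbers that are non-decreasing and satisfy
the `Δ₂`-condition `ν_{2n} ≤ C ν_n` for all `n ≥ 1`. -/
structure IsWeightMinus (ν : ℕ+ → ℝ) : Prop where
  pos : ∀ n, 0 < ν n
  le_succ : ∀ n, ν n ≤ ν (n + 1)
  delta_two : ∃ C : ℝ, 0 < C ∧ ∀ n, ν (2 * n) ≤ C * ν n

section OrliczSpace

variable {I : Type}

/-- The modular `∑ₙ Φ(|cₙ| φₙ / r) wₙ`, with values in `[0, ∞]`. -/
def modular (Φ : ℝ → ℝ) (φ w : I → ℝ) (c : I → ℂ) (r : ℝ) : ℝ≥0∞ :=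
  ∑' n, ENNReal.ofReal (Φ (‖c n‖ * φ n / r) * w n)

/-- Membership in the two-weighted Orlicz sequence space `ℓ^Φ_{φ,w}(I)`. -/
def MemOrlicz (Φ : ℝ → ℝ) (φ w : I → ℝ) (c : I → ℂ) : Prop :=
  ∃ r : ℝ, 0 < r ∧ modular Φ φ w c r < ∞

/-- The (Luxemburg) norm of the two-weighted Orlicz sequence space `ℓ^Φ_{φ,w}(I)`. -/
def orliczNorm (Φ : ℝ → ℝ) (φ w : I → ℝ) (c : I → ℂ) : ℝ :=
  sInf {r : ℝ | 0 < r ∧ modular Φ φ w c r ≤ 1}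

end OrliczSpace

/-- The Fourier coefficient `f_n = (1/2π) ∫₀^{2π} f(e^{iθ}) e^{-inθ} dθ`. -/
def coeff (f : Circle → ℂ) (n : ℤ) : ℂ :=
  (1 / (2 * (Real.pi : ℂ))) *
    ∫ θ in (0 : ℝ)..(2 * Real.pi), f (Circle.exp θ) * Complex.exp (-Complex.I * n * θ)

/-- The set `W ∩ Fℓ^{Φ,Ψ}_{φ,w;ψ,ρ}`: functions on the circle with absolutely summable Fourier
coefficients (each represented by its continuous representative) whose negative Fourier
coefficients lie in `ℓ^Φ_{φ,w}(ℕ)` and whose nonnegative ones lie in `ℓ^Ψ_{ψ,ρ}(ℤ₊)`. -/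
def wienerOrlicz (Φ Ψ : ℝ → ℝ) (φ w : ℕ+ → ℝ) (ψ ρ : ℕ → ℝ) : Set (Circle → ℂ) :=
  {f | Continuous f ∧ Summable (fun n : ℤ => ‖coeff f n‖) ∧
    MemOrlicz Φ φ w (fun n : ℕ+ => coeff f (-(n : ℤ))) ∧
    MemOrlicz Ψ ψ ρ (fun n : ℕ => coeff f (n : ℤ))}

/-- The norm `‖f‖_W + ‖f‖₋ + ‖f‖₊` of `W ∩ Fℓ^{Φ,Ψ}_{φ,w;ψ,ρ}`. -/
def wienerOrliczNorm (Φ Ψ : ℝ → ℝ) (φ w : ℕ+ → ℝ) (ψ ρ : ℕ → ℝ) (f : Circle → ℂ) : ℝ :=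
  (∑' n : ℤ, ‖coeff f n‖) +
    orliczNorm Φ φ w (fun n : ℕ+ => coeff f (-(n : ℤ))) +
    orliczNorm Ψ ψ ρ (fun n : ℕ => coeff f (n : ℤ))

/-- `N` is a complete norm on the complex algebra `A` for which multiplication is bounded:
`N (f g) ≤ C N(f) N(g)` (so `C N` is a submultiplicative complete norm). -/
structure IsBanachAlgebraNorm (A : Type) [CommRing A] [Algebra ℂ A] (N : A → ℝ) : Prop where
  nonneg : ∀ f, 0 ≤ N f
  eq_zero_iff : ∀ f, N f = 0 ↔ f = 0
  smul : ∀ (z : ℂ) (f : A), N (z • f) = ‖z‖ * N f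
  add_le : ∀ f g, N (f + g) ≤ N f + N g
  mul_le : ∃ C : ℝ, 0 < C ∧ ∀ f g, N (f * g) ≤ C * N f * N g
  complete : ∀ u : ℕ → A,
    (∀ ε : ℝ, 0 < ε → ∃ k, ∀ m, k ≤ m → ∀ n, k ≤ n → N (u m - u n) < ε) →
    ∃ f : A, Filter.Tendsto (fun n => N (u n - f)) Filter.atTop (𝓝 0)

/-- The maximal ideal space of a unital commutative Banach algebra, as the set of all unital algebra
homomorphisms to `ℂ` (these are automatically continuous). -/
def MaximalIdealSpace (A : Type) [CommRing A] [Algebra ℂ A] : Type := A →ₐ[ℂ] ℂ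

/-- The Gelfand topology: the topology of pointwise convergence on the algebra. -/
instance (A : Type) [CommRing A] [Algebra ℂ A] : TopologicalSpace (MaximalIdealSpace A) :=
  TopologicalSpace.induced (fun (χ : A →ₐ[ℂ] ℂ) (f : A) => χ f) Pi.topologicalSpace

/-- Evaluation at a point of the circle, on an algebra of functions on the circle. -/
def evalAt (A : Subalgebra ℂ (Circle → ℂ)) (t : Circle) : A →ₐ[ℂ] ℂ :=
  (Pi.evalAlgHom ℂ (fun _ : Circle => ℂ) t).comp A.val

/-- The evaluation at a point of the circle as a point of the maximal ideal space. -/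
def evalPoint (A : Subalgebra ℂ (Circle → ℂ)) (t : Circle) : MaximalIdealSpace A := evalAt A t

/-- The non-vanishing continuous function `b` on the circle has Cauchy index (winding number about
the origin) `κ`: along `x ↦ e^{ix}`, a continuous argument of `b` increases by `2πκ` over
`[0, 2π]`. -/
def HasCauchyIndex (b : Circle → ℂ) (κ : ℤ) : Prop :=
  ∃ θ : ℝ → ℝ, Continuous θ ∧
    (∀ x, b (Circle.exp x) = (‖b (Circle.exp x)‖ : ℂ) * Complex.exp (Complex.I * θ x)) ∧
    θ (2 * Real.pi) - θ 0 = 2 * Real.pi * κ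

/-- `a` is a logarithm of `b`. -/
def IsLogOf (a b : Circle → ℂ) : Prop := ∀ t, Complex.exp (a t) = b t

/-- `G(b) = exp ((log b)₀)`, where `a = log b`. -/
def geomMean (a : Circle → ℂ) : ℂ := Complex.exp (coeff a 0)

/-- `b₊(t) = exp (∑_{n ≥ 1} (log b)_n t^n)`, where `a = log b`. -/
def factorPlus (a : Circle → ℂ) (t : Circle) : ℂ :=
  Complex.exp (∑' n : ℕ+, coeff a (n : ℤ) * (t : ℂ) ^ (n : ℤ))

/-- `b₋(t) = exp (∑_{n ≥ 1} (log b)_{-n} t^{-n})`, where `a = log b`. -/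
def factorMinus (a : Circle → ℂ) (t : Circle) : ℂ :=
  Complex.exp (∑' n : ℕ+, coeff a (-(n : ℤ)) * (t : ℂ) ^ (-(n : ℤ)))

end OrliczWiener

end

open scoped ENNReal Topology

noncomputable section

namespace OrliczWiener

/-! ### Orlicz functions -/

namespace IsOrliczFunction

variable {Φ : ℝ → ℝ}

/-! Everything rests on one differential-norm inequality for convolution,
`exists_coeffNorm_conv_le`: with `W` the ℓ¹ norm of the Fourier coefficients and `N` the full norm,
`N(fg) ≤ K (W(g) N(f) + W(f) N(g))`. If `j + k = n`, one of `j`, `k` lies on the same side of the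
origin as `n` and has modulus at least `|n|/2`, so monotonicity and the doubling condition bound
both weights at `n` by a constant times those at that index. Jensen's inequality, with the
ℓ¹-normalised other factor as probability weights, then gives the Luxemburg estimate
(`modular_sum_mul_le_one`). Completeness comes from lower semicontinuity of the modular.

Taking `f = g` and squaring repeatedly gives `N(f^(2^k)) ≤ K^k W(f)^(2^k - 1) N(f)` up to the value
of `K`. Since `K^k` is only polynomial in `2^k`, the spectral radius of `f` is at most `W(f)`, so
every character is bounded by `W` (`norm_algHom_le_tsum`). This is decisive because trigonometric
polynomials are dense for `W` but need not be dense for `N`, no growth condition being imposed on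
the Orlicz functions. A character sends `t` to a number of modulus one, and density then makes it a
point evaluation (`exists_eq_evalAt`).

For the logarithm, index zero gives a continuous `l` with `e^l = b`. A trigonometric polynomial `p`
uniformly close to `l` makes `b e^(-p)` uniformly close to `1`. All characters being evaluations,
the spectral radius of `1 - b e^(-p)` is below one and the logarithmic series converges in the
algebra. The factorization splits the Fourier series of the logarithm by the sign of the frequency;
each half stays in the algebra because membership depends only on the moduli of the coefficients. -/

lemma nonneg (h : IsOrliczFunction Φ) {t : ℝ} (ht : 0 ≤ t) : 0 ≤ Φ t := by
  simpa [h.map_zero] using h.monotoneOn (Set.self_mem_Ici) ht ht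

lemma mono (h : IsOrliczFunction Φ) {s t : ℝ} (hs : 0 ≤ s) (hst : s ≤ t) : Φ s ≤ Φ t :=
  h.monotoneOn hs (hs.trans hst) hst

/-- Jensen's inequality for weights of total mass at most one. -/
lemma map_sum_le (h : IsOrliczFunction Φ) {J : Type*} (s : Finset J) (p x : J → ℝ)
    (hp : ∀ j ∈ s, 0 ≤ p j) (hp1 : ∑ j ∈ s, p j ≤ 1) (hx : ∀ j ∈ s, 0 ≤ x j) :
    Φ (∑ j ∈ s, p j * x j) ≤ ∑ j ∈ s, p j * Φ (x j) := by
  have := h.convexOn.map_add_sum_le (t := s) (w := p) (p := x) (v := 1 - ∑ j ∈ s, p j) (q := 0)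
    hp (by ring) hx (by linarith) Set.self_mem_Ici
  simpa [h.map_zero] using this

lemma map_mul_le (h : IsOrliczFunction Φ) {a t : ℝ} (ha : 0 ≤ a) (ha1 : a ≤ 1) (ht : 0 ≤ t) :
    Φ (a * t) ≤ a * Φ t := by
  simpa using h.map_sum_le {()} (fun _ => a) (fun _ => t) (by simp [ha]) (by simp [ha1])
    (by simp [ht])

end IsOrliczFunction

/-! ### The Luxemburg norm -/

section Luxemburg

variable {I : Type} {Φ : ℝ → ℝ} {φ w : I → ℝ}

lemma modular_mono (h : IsOrliczFunction Φ) (hφ : ∀ n, 0 < φ n) (hw : ∀ n, 0 < w n) {c d : I → ℂ}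
    {r s : ℝ} (hr : 0 < r) (hcd : ∀ n, ‖c n‖ / r ≤ ‖d n‖ / s) :
    modular Φ φ w c r ≤ modular Φ φ w d s := by
  refine ENNReal.tsum_le_tsum fun n => ENNReal.ofReal_le_ofReal ?_
  refine mul_le_mul_of_nonneg_right (h.mono ?_ ?_) (hw n).le
  · have := (hφ n).le
    positivity
  · have := mul_le_mul_of_nonneg_right (hcd n) (hφ n).le
    calc ‖c n‖ * φ n / r = ‖c n‖ / r * φ n := by ring
      _ ≤ ‖d n‖ / s * φ n := this
      _ = _ := by ring

lemma modular_mono_norm (h : IsOrliczFunction Φ) (hφ : ∀ n, 0 < φ n) (hw : ∀ n, 0 < w n)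
    {c d : I → ℂ} {r : ℝ} (hr : 0 < r) (hcd : ∀ n, ‖c n‖ ≤ ‖d n‖) :
    modular Φ φ w c r ≤ modular Φ φ w d r :=
  modular_mono h hφ hw hr fun n => by gcongr; exact hcd n

lemma modular_anti (h : IsOrliczFunction Φ) (hφ : ∀ n, 0 < φ n) (hw : ∀ n, 0 < w n)
    (c : I → ℂ) {r s : ℝ} (hr : 0 < r) (hrs : r ≤ s) :
    modular Φ φ w c s ≤ modular Φ φ w c r :=
  modular_mono h hφ hw (hr.trans_le hrs) fun n => by gcongr

lemma modular_mul_le (h : IsOrliczFunction Φ) (hφ : ∀ n, 0 < φ n) (hw : ∀ n, 0 < w n)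
    (c : I → ℂ) {r k : ℝ} (hr : 0 < r) (hk : 1 ≤ k) :
    modular Φ φ w c (k * r) ≤ ENNReal.ofReal k⁻¹ * modular Φ φ w c r := by
  have hk0 : 0 < k := by linarith
  rw [modular, modular, ← ENNReal.tsum_mul_left]
  refine ENNReal.tsum_le_tsum fun n => ?_
  rw [← ENNReal.ofReal_mul (by positivity), ← mul_assoc]
  refine ENNReal.ofReal_le_ofReal (mul_le_mul_of_nonneg_right ?_ (hw n).le)
  have := h.map_mul_le (a := k⁻¹) (t := ‖c n‖ * φ n / r) (by positivity) (inv_le_one_of_one_le₀ hk)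
    (by have := (hφ n).le; positivity)
  have e : ‖c n‖ * φ n / (k * r) = k⁻¹ * (‖c n‖ * φ n / r) := by field_simp
  rwa [e]

/-- Convexity and `Φ 0 = 0` give `Φ (t / k) ≤ Φ t / k` for `k ≥ 1`, so enlarging the radius by the
factor `max 1 m` brings a finite modular `m` down to at most one. -/
lemma MemOrlicz.exists_modular_le_one (h : IsOrliczFunction Φ) (hφ : ∀ n, 0 < φ n)
    (hw : ∀ n, 0 < w n) {c : I → ℂ} (hc : MemOrlicz Φ φ w c) :
    ∃ r, 0 < r ∧ modular Φ φ w c r ≤ 1 := by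
  obtain ⟨r, hr, hfin⟩ := hc
  set m := modular Φ φ w c r with hm
  have hk : 1 ≤ max 1 m.toReal := le_max_left _ _
  refine ⟨max 1 m.toReal * r, by positivity, (modular_mul_le h hφ hw c hr hk).trans ?_⟩
  rw [← hm, ← ENNReal.ofReal_toReal hfin.ne, ← ENNReal.ofReal_mul (by positivity),
    ENNReal.toReal_ofReal ENNReal.toReal_nonneg]
  refine ENNReal.ofReal_le_one.2 ?_
  rw [inv_mul_le_iff₀ (by positivity), mul_one]
  exact le_max_right _ _

lemma memOrlicz_iff (h : IsOrliczFunction Φ) (hφ : ∀ n, 0 < φ n) (hw : ∀ n, 0 < w n) {c : I → ℂ} :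
    MemOrlicz Φ φ w c ↔ ∃ r, 0 < r ∧ modular Φ φ w c r ≤ 1 :=
  ⟨fun hc => hc.exists_modular_le_one h hφ hw,
    fun ⟨r, hr, hm⟩ => ⟨r, hr, hm.trans_lt ENNReal.one_lt_top⟩⟩

lemma orliczNorm_nonneg (c : I → ℂ) : 0 ≤ orliczNorm Φ φ w c :=
  Real.sInf_nonneg fun _ hr => hr.1.le

lemma orliczNorm_le {c : I → ℂ} {r : ℝ} (hr : 0 < r) (hm : modular Φ φ w c r ≤ 1) :
    orliczNorm Φ φ w c ≤ r :=
  csInf_le ⟨0, fun _ hs => hs.1.le⟩ ⟨hr, hm⟩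

/-- The strict inequality avoids any question of whether the infimum is attained, and covers
sequences of norm zero. -/
lemma MemOrlicz.modular_le_one (h : IsOrliczFunction Φ) (hφ : ∀ n, 0 < φ n)
    (hw : ∀ n, 0 < w n) {c : I → ℂ} (hc : MemOrlicz Φ φ w c) {r : ℝ}
    (hr : orliczNorm Φ φ w c < r) : modular Φ φ w c r ≤ 1 := by
  obtain ⟨s, ⟨hs, hm⟩, hsr⟩ := exists_lt_of_csInf_lt (hc.exists_modular_le_one h hφ hw) hr
  exact (modular_anti h hφ hw c hs hsr.le).trans hm

/-- Convexity with the weights `r / (r + s)` and `s / (r + s)`; this is the triangle inequality for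
the Luxemburg norm. -/
lemma modular_add_le_one (h : IsOrliczFunction Φ) (hφ : ∀ n, 0 < φ n) (hw : ∀ n, 0 < w n)
    {c d : I → ℂ} {r s : ℝ} (hr : 0 < r) (hs : 0 < s) (hc : modular Φ φ w c r ≤ 1)
    (hd : modular Φ φ w d s ≤ 1) : modular Φ φ w (c + d) (r + s) ≤ 1 := by
  have hp : 0 ≤ r / (r + s) := by positivity
  have hq : 0 ≤ s / (r + s) := by positivity
  have hpq : r / (r + s) + s / (r + s) = 1 := by field_simp
  calc modular Φ φ w (c + d) (r + s)
      ≤ ∑' n, (ENNReal.ofReal (r / (r + s)) * ENNReal.ofReal (Φ (‖c n‖ * φ n / r) * w n) +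
          ENNReal.ofReal (s / (r + s)) * ENNReal.ofReal (Φ (‖d n‖ * φ n / s) * w n)) := by
        refine ENNReal.tsum_le_tsum fun n => ?_
        have h1 : 0 ≤ ‖c n‖ * φ n / r := by have := (hφ n).le; positivity
        have h2 : 0 ≤ ‖d n‖ * φ n / s := by have := (hφ n).le; positivity
        rw [← ENNReal.ofReal_mul hp, ← ENNReal.ofReal_mul hq, ← ENNReal.ofReal_add
          (mul_nonneg hp (mul_nonneg (h.nonneg h1) (hw n).le))
          (mul_nonneg hq (mul_nonneg (h.nonneg h2) (hw n).le))]
        refine ENNReal.ofReal_le_ofReal ?_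
        rw [← mul_assoc, ← mul_assoc, ← add_mul]
        refine mul_le_mul_of_nonneg_right ?_ (hw n).le
        have h3 := h.convexOn.2 (Set.mem_Ici.2 h1) (Set.mem_Ici.2 h2) hp hq hpq
        refine le_trans (h.mono (by have := (hφ n).le; positivity) ?_) h3
        simp only [Pi.add_apply, smul_eq_mul]
        have : r / (r + s) * (‖c n‖ * φ n / r) + s / (r + s) * (‖d n‖ * φ n / s) =
            (‖c n‖ + ‖d n‖) * φ n / (r + s) := by field_simp
        rw [this]
        have := (hφ n).le
        gcongr
        exact norm_add_le _ _
    _ = ENNReal.ofReal (r / (r + s)) * modular Φ φ w c r +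
          ENNReal.ofReal (s / (r + s)) * modular Φ φ w d s := by
        rw [ENNReal.tsum_add, ENNReal.tsum_mul_left, ENNReal.tsum_mul_left, modular, modular]
    _ ≤ ENNReal.ofReal (r / (r + s)) * 1 + ENNReal.ofReal (s / (r + s)) * 1 := by gcongr
    _ = 1 := by rw [mul_one, mul_one, ← ENNReal.ofReal_add hp hq, hpq, ENNReal.ofReal_one]

lemma MemOrlicz.add (h : IsOrliczFunction Φ) (hφ : ∀ n, 0 < φ n) (hw : ∀ n, 0 < w n)
    {c d : I → ℂ} (hc : MemOrlicz Φ φ w c) (hd : MemOrlicz Φ φ w d) :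
    MemOrlicz Φ φ w (c + d) := by
  rw [memOrlicz_iff h hφ hw] at *
  obtain ⟨r, hr, hc⟩ := hc
  obtain ⟨s, hs, hd⟩ := hd
  exact ⟨r + s, by positivity, modular_add_le_one h hφ hw hr hs hc hd⟩

lemma orliczNorm_add_le (h : IsOrliczFunction Φ) (hφ : ∀ n, 0 < φ n) (hw : ∀ n, 0 < w n)
    {c d : I → ℂ} (hc : MemOrlicz Φ φ w c) (hd : MemOrlicz Φ φ w d) :
    orliczNorm Φ φ w (c + d) ≤ orliczNorm Φ φ w c + orliczNorm Φ φ w d := by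
  refine le_of_forall_pos_le_add fun ε hε => ?_
  have h1 := orliczNorm_nonneg (Φ := Φ) (φ := φ) (w := w) c
  have h2 := orliczNorm_nonneg (Φ := Φ) (φ := φ) (w := w) d
  have := orliczNorm_le (by positivity) (modular_add_le_one h hφ hw
    (r := orliczNorm Φ φ w c + ε / 2) (s := orliczNorm Φ φ w d + ε / 2) (by positivity)
    (by positivity) (hc.modular_le_one h hφ hw (by linarith))
    (hd.modular_le_one h hφ hw (by linarith)))
  linarith

lemma MemOrlicz.of_norm_le (h : IsOrliczFunction Φ) (hφ : ∀ n, 0 < φ n) (hw : ∀ n, 0 < w n)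
    {c d : I → ℂ} (hd : MemOrlicz Φ φ w d) (hcd : ∀ n, ‖c n‖ ≤ ‖d n‖) : MemOrlicz Φ φ w c := by
  obtain ⟨r, hr, hm⟩ := hd
  exact ⟨r, hr, (modular_mono_norm h hφ hw hr hcd).trans_lt hm⟩

lemma modular_smul (z : ℂ) (hz : z ≠ 0) (c : I → ℂ) (r : ℝ) :
    modular Φ φ w (z • c) (‖z‖ * r) = modular Φ φ w c r := by
  have hz : ‖z‖ ≠ 0 := norm_ne_zero_iff.2 hz
  refine tsum_congr fun n => ?_
  congr 3
  rw [Pi.smul_apply, norm_smul, mul_assoc, mul_div_mul_left _ _ hz]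

lemma memOrlicz_of_finite_support (h : IsOrliczFunction Φ) {c : I → ℂ}
    (hc : (Function.support c).Finite) : MemOrlicz Φ φ w c := by
  refine ⟨1, one_pos, ?_⟩
  rw [modular, tsum_eq_sum (s := hc.toFinset)]
  · exact ENNReal.sum_lt_top.2 fun _ _ => ENNReal.ofReal_lt_top
  · intro n hn
    have : c n = 0 := by simpa using hn
    simp [this, h.map_zero]

lemma orliczNorm_zero (h : IsOrliczFunction Φ) : orliczNorm Φ φ w (0 : I → ℂ) = 0 := by
  refine le_antisymm (le_of_forall_pos_le_add fun ε hε => ?_) (orliczNorm_nonneg _)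
  rw [zero_add]
  exact orliczNorm_le hε (by simp [modular, h.map_zero])

lemma MemOrlicz.smul (h : IsOrliczFunction Φ) (z : ℂ) {c : I → ℂ} (hc : MemOrlicz Φ φ w c) :
    MemOrlicz Φ φ w (z • c) := by
  rcases eq_or_ne z 0 with rfl | hz
  · rw [zero_smul]
    exact memOrlicz_of_finite_support h (by simp)
  · obtain ⟨r, hr, hm⟩ := hc
    exact ⟨‖z‖ * r, by positivity, (modular_smul z hz c r).trans_lt hm⟩

lemma orliczNorm_smul (h : IsOrliczFunction Φ) (hφ : ∀ n, 0 < φ n) (hw : ∀ n, 0 < w n)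
    (z : ℂ) {c : I → ℂ} (hc : MemOrlicz Φ φ w c) :
    orliczNorm Φ φ w (z • c) = ‖z‖ * orliczNorm Φ φ w c := by
  have key : ∀ (z : ℂ) (d : I → ℂ), z ≠ 0 → MemOrlicz Φ φ w d →
      orliczNorm Φ φ w (z • d) ≤ ‖z‖ * orliczNorm Φ φ w d := by
    intro z d hz hd
    have hz' : 0 < ‖z‖ := norm_pos_iff.2 hz
    have h1 := orliczNorm_nonneg (Φ := Φ) (φ := φ) (w := w) d
    refine le_of_forall_pos_le_add fun ε hε => ?_
    have h2 := orliczNorm_le (c := z • d) (r := ‖z‖ * (orliczNorm Φ φ w d + ε / ‖z‖))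
      (by positivity) ((modular_smul (φ := φ) (w := w) z hz d _).le.trans
      (hd.modular_le_one h hφ hw (by linarith [div_pos hε hz'])))
    rwa [mul_add, mul_div_cancel₀ _ hz'.ne'] at h2
  rcases eq_or_ne z 0 with rfl | hz
  · simp [orliczNorm_zero h]
  refine le_antisymm (key z c hz hc) ?_
  -- The reverse inequality is the same bound applied to `z⁻¹` and `z • c`.
  have := key z⁻¹ (z • c) (inv_ne_zero hz) (hc.smul h z)
  rwa [inv_smul_smul₀ hz, norm_inv, ← div_eq_inv_mul, le_div_iff₀ (norm_pos_iff.2 hz),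
    mul_comm] at this

/-- The modular is lower semicontinuous for pointwise convergence. -/
lemma modular_le_of_tendsto (h : IsOrliczFunction Φ) (hφ : ∀ n, 0 < φ n) {J : Type*}
    {l : Filter J} [l.NeBot] {u : J → I → ℂ} {c : I → ℂ}
    (hu : ∀ n, Filter.Tendsto (fun j => u j n) l (𝓝 (c n))) {r : ℝ} (hr : 0 < r) {B : ℝ≥0∞}
    (hB : ∀ᶠ j in l, modular Φ φ w (u j) r ≤ B) : modular Φ φ w c r ≤ B := by
  rw [modular, ENNReal.tsum_eq_iSup_sum]
  refine iSup_le fun s => ?_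
  have hlim : Filter.Tendsto (fun j => ∑ n ∈ s, ENNReal.ofReal (Φ (‖u j n‖ * φ n / r) * w n)) l
      (𝓝 (∑ n ∈ s, ENNReal.ofReal (Φ (‖c n‖ * φ n / r) * w n))) := by
    refine tendsto_finsetSum _ fun n _ => (ENNReal.continuous_ofReal.tendsto _).comp ?_
    refine Filter.Tendsto.mul_const _ ?_
    have hn : ∀ z : ℂ, 0 ≤ ‖z‖ * φ n / r := fun z => by have := (hφ n).le; positivity
    -- `Φ` is continuous only on `[0, ∞)`, so convergence is needed within that set.
    have h1 : Filter.Tendsto (fun j => ‖u j n‖ * φ n / r) l (𝓝[Set.Ici 0] (‖c n‖ * φ n / r)) :=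
      tendsto_nhdsWithin_iff.2 ⟨((hu n).norm.mul_const _).div_const _, .of_forall fun _ => hn _⟩
    exact (h.continuousOn _ (hn _)).tendsto.comp h1
  exact le_of_tendsto hlim (hB.mono fun j hj => (ENNReal.sum_le_tsum s).trans hj)

end Luxemburg

/-! ### Convolution -/

/-- The weight `ν` on `I ⊆ ℤ` is almost dominated by its value at one of two summands. -/
def IsConvWeight {I : Type} (ι : I → ℤ) (φ w : I → ℝ) (C : ℝ) : Prop :=
  ∀ (n : I) (j k : ℤ), j + k = ι n →
    (∃ i, ι i = j ∧ φ n ≤ C * φ i ∧ w n ≤ C * w i) ∨ (∃ i, ι i = k ∧ φ n ≤ C * φ i ∧ w n ≤ C * w i)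

section Convolution

variable {I : Type} {Φ : ℝ → ℝ} {φ w : I → ℝ} {ι : I → ℤ}

lemma tsum_ofReal_norm_comp_le (hι : Function.Injective ι) {g : ℤ → ℂ}
    (hg : Summable fun n => ‖g n‖) (e : ℤ ≃ ℤ) :
    ∑' n, ENNReal.ofReal ‖g (e (ι n))‖ ≤ ENNReal.ofReal (∑' n, ‖g n‖) := by
  rw [ENNReal.ofReal_tsum_of_nonneg (fun _ => norm_nonneg _) hg]
  exact ENNReal.tsum_comp_le_tsum_of_injective (e.injective.comp hι) fun n => ENNReal.ofReal ‖g n‖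

/-- One half of the convolution estimate. -/
lemma tsum_tsum_ofReal_le (hι : Function.Injective ι) {f g : ℤ → ℂ} (hg : Summable fun n => ‖g n‖)
    {G r : ℝ} (hG : 0 < G) (hGg : ∑' n, ‖g n‖ ≤ G) (hf : modular Φ φ w (fun n => f (ι n)) r ≤ 1)
    (T : I → ℤ → ℝ) (hT : ∀ n j, T n j ≠ 0 →
      ∃ i, ι i = j ∧ T n j ≤ ‖g (ι n - j)‖ / (2 * G) * (Φ (‖f (ι i)‖ * φ i / r) * w i)) :
    ∑' n, ∑' j, ENNReal.ofReal (T n j) ≤ ENNReal.ofReal (1 / 2) := by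
  classical
  -- Once the sums are interchanged, the kernel `|g (n - i)| / (2G)` has mass at most `1/2` for each
  -- fixed `i`.
  have h2 : ∀ i, ∑' n, ENNReal.ofReal (‖g (ι n - ι i)‖ / (2 * G)) ≤ ENNReal.ofReal (1 / 2) := by
    intro i
    have := tsum_ofReal_norm_comp_le hι hg (Equiv.subRight (ι i))
    have h3 : ∀ n, ENNReal.ofReal (‖g (ι n - ι i)‖ / (2 * G)) =
        ENNReal.ofReal ‖g (Equiv.subRight (ι i) (ι n))‖ * ENNReal.ofReal (1 / (2 * G)) := by
      intro n
      rw [← ENNReal.ofReal_mul (norm_nonneg _), Equiv.subRight_apply, mul_one_div]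
    simp_rw [h3]
    rw [ENNReal.tsum_mul_right]
    refine (mul_le_mul_left (this.trans (ENNReal.ofReal_le_ofReal hGg)) _).trans ?_
    rw [← ENNReal.ofReal_mul hG.le]
    refine ENNReal.ofReal_le_ofReal (le_of_eq ?_)
    field_simp
  calc ∑' n, ∑' j, ENNReal.ofReal (T n j)
      ≤ ∑' n, ∑' i, ENNReal.ofReal (‖g (ι n - ι i)‖ / (2 * G)) *
          ENNReal.ofReal (Φ (‖f (ι i)‖ * φ i / r) * w i) := by
        refine ENNReal.tsum_le_tsum fun n => ?_
        set F : I → ℝ≥0∞ := fun i => ENNReal.ofReal (‖g (ι n - ι i)‖ / (2 * G)) *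
          ENNReal.ofReal (Φ (‖f (ι i)‖ * φ i / r) * w i)
        -- `T n` lives on the range of `ι`, so the sum over `ℤ` is dominated by one over `I`,
        -- extended by zero.
        have h4 : ∀ j, ENNReal.ofReal (T n j) ≤ Function.extend ι F 0 j := by
          intro j
          by_cases h0 : T n j = 0
          · simp [h0]
          · obtain ⟨i, rfl, hi⟩ := hT n j h0
            rw [hι.extend_apply]
            exact (ENNReal.ofReal_le_ofReal hi).trans (ENNReal.ofReal_mul (by positivity)).le
        exact (ENNReal.tsum_le_tsum h4).trans (tsum_extend_zero hι F).le
    _ = ∑' i, (∑' n, ENNReal.ofReal (‖g (ι n - ι i)‖ / (2 * G))) *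
          ENNReal.ofReal (Φ (‖f (ι i)‖ * φ i / r) * w i) := by
        rw [ENNReal.tsum_comm]
        exact tsum_congr fun i => ENNReal.tsum_mul_right
    _ ≤ ∑' i, ENNReal.ofReal (1 / 2) * ENNReal.ofReal (Φ (‖f (ι i)‖ * φ i / r) * w i) :=
        ENNReal.tsum_le_tsum fun i => mul_le_mul_left (h2 i) _
    _ = ENNReal.ofReal (1 / 2) * modular Φ φ w (fun n => f (ι n)) r := by
        rw [ENNReal.tsum_mul_left, modular]
    _ ≤ ENNReal.ofReal (1 / 2) := by
        simpa using mul_le_mul_right hf (ENNReal.ofReal (1 / 2))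

/-- For each `n`, the indices `j` are split according to whether `j` or `n - j` carries the weight
at `n`. Jensen is applied with the other factor as the weight, and summation over `n` leaves the
modular of `f` or of `g`, each with factor `1/2`. A finite `S` suffices, as the bound does not
depend on it. -/
lemma modular_sum_mul_le_one (h : IsOrliczFunction Φ) (hφ : ∀ n, 0 < φ n) (hw : ∀ n, 0 < w n)
    (hι : Function.Injective ι) {C : ℝ} (hC : 1 ≤ C) (hconv : IsConvWeight ι φ w C)
    {f g : ℤ → ℂ} (hf : Summable fun n => ‖f n‖) (hg : Summable fun n => ‖g n‖) {F G r s : ℝ}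
    (hF : 0 < F) (hG : 0 < G) (hr : 0 < r) (hs : 0 < s) (hFf : ∑' n, ‖f n‖ ≤ F)
    (hGg : ∑' n, ‖g n‖ ≤ G) (hfr : modular Φ φ w (fun n => f (ι n)) r ≤ 1)
    (hgs : modular Φ φ w (fun n => g (ι n)) s ≤ 1) (S : Finset ℤ) :
    modular Φ φ w (fun n => ∑ j ∈ S, f j * g (ι n - j)) (2 * C ^ 2 * (G * r + F * s)) ≤ 1 := by
  classical
  set R := 2 * C ^ 2 * (G * r + F * s) with hR
  have hC0 : 0 < C := by linarith
  have hR0 : 0 < R := by positivity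
  set P : I → ℤ → Prop := fun n j => ∃ i, ι i = j ∧ φ n ≤ C * φ i ∧ w n ≤ C * w i with hP
  have hPQ : ∀ n j, ¬ P n j → P n (ι n - j) := fun n j hj =>
    (hconv n j (ι n - j) (by ring)).resolve_left hj
  -- the Jensen weights and values
  set p : I → ℤ → ℝ := fun n j =>
    if P n j then ‖g (ι n - j)‖ / (2 * G) else ‖f j‖ / (2 * F) with hp
  set x : I → ℤ → ℝ := fun n j =>
    if P n j then 2 * G * ‖f j‖ * φ n / R else 2 * F * ‖g (ι n - j)‖ * φ n / R with hx
  have hp0 : ∀ n j, 0 ≤ p n j := by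
    intro n j
    simp only [hp]
    split_ifs <;> positivity
  have hx0 : ∀ n j, 0 ≤ x n j := by
    intro n j
    have := (hφ n).le
    simp only [hx]
    split_ifs <;> positivity
  have hpx : ∀ n j, p n j * x n j = ‖f j * g (ι n - j)‖ * φ n / R := by
    intro n j
    simp only [hp, hx, norm_mul]
    split_ifs <;> field_simp
  have hp1 : ∀ n, ∑ j ∈ S, p n j ≤ 1 := by
    intro n
    have h1 : ∀ j, p n j ≤ ‖g (ι n - j)‖ / (2 * G) + ‖f j‖ / (2 * F) := by
      intro j
      have h2 : 0 ≤ ‖g (ι n - j)‖ / (2 * G) := by positivity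
      have h3 : 0 ≤ ‖f j‖ / (2 * F) := by positivity
      simp only [hp]
      split_ifs <;> linarith
    have hg' : Summable fun j => ‖g (ι n - j)‖ := hg.comp_injective (Equiv.subLeft (ι n)).injective
    have h4 : ∑ j ∈ S, ‖g (ι n - j)‖ ≤ G := by
      refine (hg'.sum_le_tsum S fun _ _ => norm_nonneg _).trans (le_trans (le_of_eq ?_) hGg)
      exact (Equiv.subLeft (ι n)).tsum_eq fun j => ‖g j‖
    have h5 : ∑ j ∈ S, ‖f j‖ ≤ F := (hf.sum_le_tsum S fun _ _ => norm_nonneg _).trans hFf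
    calc ∑ j ∈ S, p n j ≤ (∑ j ∈ S, ‖g (ι n - j)‖) / (2 * G) + (∑ j ∈ S, ‖f j‖) / (2 * F) := by
          rw [Finset.sum_div, Finset.sum_div, ← Finset.sum_add_distrib]
          exact Finset.sum_le_sum fun j _ => h1 j
      _ ≤ G / (2 * G) + F / (2 * F) := by gcongr
      _ = 1 := by field_simp; norm_num
  -- Of the factor `C ^ 2` in `R`, one `C` absorbs the passage from `φ n` to `φ i`; the other is
  -- pulled out of `Φ` by convexity and absorbs the passage from `w n` to `w i`.
  have hterm : ∀ (u : ℤ → ℂ) (H t : ℝ) (n i : I), 0 < t → 0 < H → 2 * C ^ 2 * (H * t) ≤ R →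
      φ n ≤ C * φ i → w n ≤ C * w i →
      Φ (2 * H * ‖u (ι i)‖ * φ n / R) * w n ≤ Φ (‖u (ι i)‖ * φ i / t) * w i := by
    intro u H t n i ht hH hHR h1 h2
    have hφi := (hφ i).le
    have hφn := (hφ n).le
    have hy : 0 ≤ ‖u (ι i)‖ * φ i / t := by positivity
    have h3 : 2 * H * ‖u (ι i)‖ * φ n / R ≤ C⁻¹ * (‖u (ι i)‖ * φ i / t) := by
      rw [div_le_iff₀ hR0]
      calc 2 * H * ‖u (ι i)‖ * φ n ≤ 2 * H * ‖u (ι i)‖ * (C * φ i) := by gcongr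
        _ = C⁻¹ * (‖u (ι i)‖ * φ i / t) * (2 * C ^ 2 * (H * t)) := by field_simp
        _ ≤ C⁻¹ * (‖u (ι i)‖ * φ i / t) * R := by gcongr
    have h4 : Φ (2 * H * ‖u (ι i)‖ * φ n / R) ≤ C⁻¹ * Φ (‖u (ι i)‖ * φ i / t) :=
      (h.mono (by positivity) h3).trans (h.map_mul_le (by positivity) (inv_le_one_of_one_le₀ hC) hy)
    have h5 := h.nonneg hy
    calc _ ≤ C⁻¹ * Φ (‖u (ι i)‖ * φ i / t) * (C * w i) :=
          mul_le_mul h4 h2 (hw n).le (by positivity)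
      _ = _ := by field_simp
  set T₁ : I → ℤ → ℝ := fun n j => if P n j then p n j * (Φ (x n j) * w n) else 0 with hT₁
  set T₂ : I → ℤ → ℝ := fun n j => if P n j then 0 else p n j * (Φ (x n j) * w n) with hT₂
  have hT₁0 : ∀ n j, 0 ≤ T₁ n j := fun n j => by
    simp only [hT₁]
    split_ifs
    exacts [mul_nonneg (hp0 n j) (mul_nonneg (h.nonneg (hx0 n j)) (hw n).le), le_rfl]
  have hT₂0 : ∀ n j, 0 ≤ T₂ n j := fun n j => by
    simp only [hT₂]
    split_ifs
    exacts [le_rfl, mul_nonneg (hp0 n j) (mul_nonneg (h.nonneg (hx0 n j)) (hw n).le)]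
  have hsplit : modular Φ φ w (fun n => ∑ j ∈ S, f j * g (ι n - j)) R ≤
      ∑' n, ∑ j ∈ S, ENNReal.ofReal (T₁ n j) + ∑' n, ∑ j ∈ S, ENNReal.ofReal (T₂ n j) := by
    rw [← ENNReal.tsum_add]
    refine ENNReal.tsum_le_tsum fun n => ?_
    rw [← Finset.sum_add_distrib]
    simp_rw [← ENNReal.ofReal_add (hT₁0 n _) (hT₂0 n _)]
    rw [← ENNReal.ofReal_sum_of_nonneg fun j _ => add_nonneg (hT₁0 n j) (hT₂0 n j)]
    refine ENNReal.ofReal_le_ofReal ?_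
    have h1 : ∀ j, T₁ n j + T₂ n j = p n j * Φ (x n j) * w n := by
      intro j
      simp only [hT₁, hT₂]
      split_ifs <;> ring
    simp_rw [h1]
    rw [← Finset.sum_mul]
    refine mul_le_mul_of_nonneg_right ?_ (hw n).le
    refine le_trans (h.mono (by have := (hφ n).le; positivity) ?_)
      (h.map_sum_le S (p n) (x n) (fun j _ => hp0 n j) (hp1 n) fun j _ => hx0 n j)
    simp_rw [hpx]
    rw [← Finset.sum_div, ← Finset.sum_mul]
    have := (hφ n).le
    gcongr
    exact norm_sum_le _ _
  have hA : ∑' n, ∑ j ∈ S, ENNReal.ofReal (T₁ n j) ≤ ENNReal.ofReal (1 / 2) := by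
    refine (ENNReal.tsum_le_tsum fun n => ENNReal.sum_le_tsum S).trans
      (tsum_tsum_ofReal_le hι hg hG hGg hfr T₁ fun n j hne => ?_)
    have hPj : P n j := by
      by_contra hc
      simp [hT₁, hc] at hne
    have hPj' := hPj
    obtain ⟨i, rfl, h1, h2⟩ := hPj
    refine ⟨i, rfl, ?_⟩
    simp only [hT₁, hp, hx, if_pos hPj']
    refine mul_le_mul_of_nonneg_left (hterm f G r n i hr hG ?_ h1 h2) (by positivity)
    rw [hR]
    gcongr
    exact le_add_of_nonneg_right (by positivity)
  have hB : ∑' n, ∑ j ∈ S, ENNReal.ofReal (T₂ n j) ≤ ENNReal.ofReal (1 / 2) := by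
    -- The substitution `k = n - j` exchanges the roles of `f` and `g`.
    have hre : ∀ n, ∑ j ∈ S, ENNReal.ofReal (T₂ n j) ≤
        ∑' k, ENNReal.ofReal (T₂ n (ι n - k)) := fun n =>
      (ENNReal.sum_le_tsum S).trans
        ((Equiv.subLeft (ι n)).tsum_eq fun j => ENNReal.ofReal (T₂ n j)).ge
    refine (ENNReal.tsum_le_tsum hre).trans
      (tsum_tsum_ofReal_le hι hf hF hFf hgs (fun n k => T₂ n (ι n - k)) fun n k hne => ?_)
    have hPk : ¬ P n (ι n - k) := by
      intro hc
      simp [hT₂, hc] at hne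
    obtain ⟨i, hi, h1, h2⟩ := hPQ n _ hPk
    rw [sub_sub_cancel] at hi
    subst hi
    refine ⟨i, rfl, ?_⟩
    simp only [hT₂, hp, hx, if_neg hPk, sub_sub_cancel]
    refine mul_le_mul_of_nonneg_left (hterm g F s n i hs hF ?_ h1 h2) (by positivity)
    rw [hR]
    gcongr
    exact le_add_of_nonneg_left (by positivity)
  calc _ ≤ ENNReal.ofReal (1 / 2) + ENNReal.ofReal (1 / 2) := hsplit.trans (add_le_add hA hB)
    _ = 1 := by rw [← ENNReal.ofReal_add (by norm_num) (by norm_num)]; norm_num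

/-- The sequence of Fourier coefficients of a product. -/
def conv (f g : ℤ → ℂ) (n : ℤ) : ℂ := ∑' j, f j * g (n - j)

lemma summable_mul_sub {f g : ℤ → ℂ} (hf : Summable fun n => ‖f n‖) (hg : Summable fun n => ‖g n‖)
    (n : ℤ) : Summable fun j => f j * g (n - j) := by
  refine Summable.of_norm_bounded (hf.mul_right (∑' k, ‖g k‖)) fun j => ?_
  rw [norm_mul]
  exact mul_le_mul_of_nonneg_left (hg.le_tsum _ fun _ _ => norm_nonneg _) (norm_nonneg _)

/-- The bound for finite partial sums is uniform, so lower semicontinuity of the modular carries it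
to the full convolution. -/
lemma modular_conv_le_one (h : IsOrliczFunction Φ) (hφ : ∀ n, 0 < φ n) (hw : ∀ n, 0 < w n)
    (hι : Function.Injective ι) {C : ℝ} (hC : 1 ≤ C) (hconv : IsConvWeight ι φ w C)
    {f g : ℤ → ℂ} (hf : Summable fun n => ‖f n‖) (hg : Summable fun n => ‖g n‖) {F G r s : ℝ}
    (hF : 0 < F) (hG : 0 < G) (hr : 0 < r) (hs : 0 < s) (hFf : ∑' n, ‖f n‖ ≤ F)
    (hGg : ∑' n, ‖g n‖ ≤ G) (hfr : modular Φ φ w (fun n => f (ι n)) r ≤ 1)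
    (hgs : modular Φ φ w (fun n => g (ι n)) s ≤ 1) :
    modular Φ φ w (fun n => conv f g (ι n)) (2 * C ^ 2 * (G * r + F * s)) ≤ 1 :=
  modular_le_of_tendsto (l := Filter.atTop) h hφ (fun n => (summable_mul_sub hf hg (ι n)).hasSum)
    (by positivity) (.of_forall fun S =>
      modular_sum_mul_le_one h hφ hw hι hC hconv hf hg hF hG hr hs hFf hGg hfr hgs S)

lemma MemOrlicz.conv (h : IsOrliczFunction Φ) (hφ : ∀ n, 0 < φ n) (hw : ∀ n, 0 < w n)
    (hι : Function.Injective ι) {C : ℝ} (hC : 1 ≤ C) (hconv : IsConvWeight ι φ w C)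
    {f g : ℤ → ℂ} (hf : Summable fun n => ‖f n‖) (hg : Summable fun n => ‖g n‖)
    (hfo : MemOrlicz Φ φ w fun n => f (ι n)) (hgo : MemOrlicz Φ φ w fun n => g (ι n)) :
    MemOrlicz Φ φ w fun n => OrliczWiener.conv f g (ι n) := by
  rw [memOrlicz_iff h hφ hw] at *
  obtain ⟨r, hr, hfr⟩ := hfo
  obtain ⟨s, hs, hgs⟩ := hgo
  have hF : 0 ≤ ∑' n, ‖f n‖ := tsum_nonneg fun _ => norm_nonneg _
  have hG : 0 ≤ ∑' n, ‖g n‖ := tsum_nonneg fun _ => norm_nonneg _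
  exact ⟨_, by positivity, modular_conv_le_one h hφ hw hι hC hconv hf hg
    (F := ∑' n, ‖f n‖ + 1) (G := ∑' n, ‖g n‖ + 1) (by linarith) (by linarith) hr hs
    (by linarith) (by linarith) hfr hgs⟩

/-- The differential-norm inequality for the Luxemburg norm of a convolution. -/
lemma orliczNorm_conv_le (h : IsOrliczFunction Φ) (hφ : ∀ n, 0 < φ n) (hw : ∀ n, 0 < w n)
    (hι : Function.Injective ι) {C : ℝ} (hC : 1 ≤ C) (hconv : IsConvWeight ι φ w C)
    {f g : ℤ → ℂ} (hf : Summable fun n => ‖f n‖) (hg : Summable fun n => ‖g n‖)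
    (hfo : MemOrlicz Φ φ w fun n => f (ι n)) (hgo : MemOrlicz Φ φ w fun n => g (ι n)) :
    orliczNorm Φ φ w (fun n => conv f g (ι n)) ≤
      2 * C ^ 2 * ((∑' n, ‖g n‖) * orliczNorm Φ φ w (fun n => f (ι n)) +
        (∑' n, ‖f n‖) * orliczNorm Φ φ w (fun n => g (ι n))) := by
  set F := ∑' n, ‖f n‖
  set G := ∑' n, ‖g n‖
  set r := orliczNorm Φ φ w (fun n => f (ι n)) with hr
  set s := orliczNorm Φ φ w (fun n => g (ι n)) with hs
  have hF : 0 ≤ F := tsum_nonneg fun _ => norm_nonneg _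
  have hG : 0 ≤ G := tsum_nonneg fun _ => norm_nonneg _
  have hr0 : 0 ≤ r := orliczNorm_nonneg _
  have hs0 : 0 ≤ s := orliczNorm_nonneg _
  -- The shift by `ε` makes all four parameters positive even when norms vanish, and puts the radii
  -- strictly above the Luxemburg norms.
  have key : ∀ ε : ℝ, 0 < ε → orliczNorm Φ φ w (fun n => conv f g (ι n)) ≤
      2 * C ^ 2 * ((G + ε) * (r + ε) + (F + ε) * (s + ε)) := fun ε hε =>
    orliczNorm_le (by positivity) (modular_conv_le_one h hφ hw hι hC hconv hf hg
      (by positivity) (by positivity) (by positivity) (by positivity) (by linarith) (by linarith)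
      (hfo.modular_le_one h hφ hw (by linarith)) (hgo.modular_le_one h hφ hw (by linarith)))
  have hlim : Filter.Tendsto (fun ε : ℝ => 2 * C ^ 2 * ((G + ε) * (r + ε) + (F + ε) * (s + ε)))
      (𝓝[>] 0) (𝓝 (2 * C ^ 2 * (G * r + F * s))) := by
    have : Continuous fun ε : ℝ => 2 * C ^ 2 * ((G + ε) * (r + ε) + (F + ε) * (s + ε)) := by
      fun_prop
    simpa using (this.tendsto 0).mono_left nhdsWithin_le_nhds
  exact ge_of_tendsto hlim (eventually_mem_nhdsWithin.mono key)

end Convolution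

/-! ### The weights -/

lemma IsWeightPlus.monotone {ν : ℕ → ℝ} (h : IsWeightPlus ν) : Monotone ν :=
  monotone_nat_of_le_succ h.le_succ

lemma IsWeightPlus.exists_le {ν : ℕ → ℝ} (h : IsWeightPlus ν) :
    ∃ C : ℝ, 1 ≤ C ∧ ∀ n k : ℕ, n ≤ 2 * k → ν n ≤ C * ν k := by
  obtain ⟨C, hC, hν⟩ := h.delta_two
  refine ⟨max 1 C, le_max_left _ _, fun n k hnk => ?_⟩
  refine (h.monotone hnk).trans ?_
  -- The doubling condition says nothing at `k = 0`; there a constant at least one is enough.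
  rcases Nat.eq_zero_or_pos k with rfl | hk
  · exact le_mul_of_one_le_left (h.pos _).le (le_max_left _ _)
  · exact (hν k hk).trans (mul_le_mul_of_nonneg_right (le_max_right _ _) (h.pos _).le)

lemma IsWeightMinus.monotone {ν : ℕ+ → ℝ} (h : IsWeightMinus ν) : Monotone ν := by
  have : Monotone fun n : ℕ => ν n.succPNat := monotone_nat_of_le_succ fun n => h.le_succ _
  intro m n hmn
  have h2 := this (a := m.natPred) (b := n.natPred) (PNat.natPred_le_natPred.2 hmn)
  simpa using h2

lemma IsWeightMinus.exists_le {ν : ℕ+ → ℝ} (h : IsWeightMinus ν) :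
    ∃ C : ℝ, 1 ≤ C ∧ ∀ n k : ℕ+, n ≤ 2 * k → ν n ≤ C * ν k := by
  obtain ⟨C, hC, hν⟩ := h.delta_two
  refine ⟨max 1 C, le_max_left _ _, fun n k hnk => (h.monotone hnk).trans ?_⟩
  exact (hν k).trans (mul_le_mul_of_nonneg_right (le_max_right _ _) (h.pos _).le)

lemma exists_isConvWeight_plus {φ w : ℕ → ℝ} (hφ : IsWeightPlus φ) (hw : IsWeightPlus w) :
    ∃ C : ℝ, 1 ≤ C ∧ IsConvWeight (fun n : ℕ => (n : ℤ)) φ w C := by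
  obtain ⟨C, hC, hCφ⟩ := hφ.exists_le
  obtain ⟨D, hD, hDw⟩ := hw.exists_le
  have key : ∀ n i : ℕ, n ≤ 2 * i → φ n ≤ max C D * φ i ∧ w n ≤ max C D * w i := fun n i hni =>
    ⟨(hCφ n i hni).trans (mul_le_mul_of_nonneg_right (le_max_left _ _) (hφ.pos _).le),
      (hDw n i hni).trans (mul_le_mul_of_nonneg_right (le_max_right _ _) (hw.pos _).le)⟩
  refine ⟨max C D, hC.trans (le_max_left _ _), fun n j k hjk => ?_⟩
  -- As `j + k = n`, either `2j ≥ n` or `2k ≥ n`; since `n ≥ 0`, the chosen index is a natural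
  -- number.
  rcases le_total (n : ℤ) (2 * j) with hj | hj
  · exact .inl ⟨j.toNat, by simp only; omega, key n _ (by omega)⟩
  · exact .inr ⟨k.toNat, by simp only at hjk ⊢; omega, key n _ (by simp only at hjk; omega)⟩

lemma exists_isConvWeight_minus {φ w : ℕ+ → ℝ} (hφ : IsWeightMinus φ) (hw : IsWeightMinus w) :
    ∃ C : ℝ, 1 ≤ C ∧ IsConvWeight (fun n : ℕ+ => -(n : ℤ)) φ w C := by
  obtain ⟨C, hC, hCφ⟩ := hφ.exists_le
  obtain ⟨D, hD, hDw⟩ := hw.exists_le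
  have key : ∀ n i : ℕ+, n ≤ 2 * i → φ n ≤ max C D * φ i ∧ w n ≤ max C D * w i := fun n i hni =>
    ⟨(hCφ n i hni).trans (mul_le_mul_of_nonneg_right (le_max_left _ _) (hφ.pos _).le),
      (hDw n i hni).trans (mul_le_mul_of_nonneg_right (le_max_right _ _) (hw.pos _).le)⟩
  have key' : ∀ (n : ℕ+) (j : ℤ), (n : ℤ) ≤ 2 * -j →
      ∃ i : ℕ+, -(i : ℤ) = j ∧ φ n ≤ max C D * φ i ∧ w n ≤ max C D * w i := by
    intro n j hj
    have hn : (0 : ℤ) < n := by exact_mod_cast n.pos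
    -- `n ≥ 1` forces `-j ≥ 1`, so `-j` is a legitimate index.
    obtain ⟨i, hi⟩ : ∃ i : ℕ+, (i : ℤ) = -j :=
      ⟨(-j).toNat.toPNat (by omega), by rw [Nat.toPNat, PNat.mk_coe]; omega⟩
    refine ⟨i, by omega, key n _ ?_⟩
    rw [← PNat.coe_le_coe, PNat.mul_coe, PNat.val_ofNat]
    omega
  refine ⟨max C D, hC.trans (le_max_left _ _), fun n j k hjk => ?_⟩
  rcases le_total (n : ℤ) (2 * -j) with hj | hj
  · exact .inl (key' n j hj)
  · exact .inr (key' n k (by simp only at hjk; omega))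

/-! ### Fourier series on the circle -/

/-- The monomial `t ↦ t ^ n` on the circle. -/
def monomial (n : ℤ) : C(Circle, ℂ) :=
  ⟨fun t => (t : ℂ) ^ n, (continuous_subtype_val : Continuous fun t : Circle => (t : ℂ)).zpow₀ n
    fun t => .inl (Circle.coe_ne_zero t)⟩

@[simp] lemma monomial_apply (n : ℤ) (t : Circle) : monomial n t = (t : ℂ) ^ n := rfl

lemma norm_monomial_apply (n : ℤ) (t : Circle) : ‖(t : ℂ) ^ n‖ = 1 := by
  rw [norm_zpow, Circle.norm_coe, one_zpow]

lemma norm_monomial_le (n : ℤ) : ‖monomial n‖ ≤ 1 :=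
  (ContinuousMap.norm_le _ zero_le_one).2 fun t => (norm_monomial_apply n t).le

lemma monomial_mul (m n : ℤ) : monomial m * monomial n = monomial (m + n) := by
  ext t
  simp [zpow_add₀ t.coe_ne_zero]

lemma monomial_zero : monomial 0 = 1 := by
  ext t
  simp

instance fact_two_pi_pos : Fact (0 < 2 * Real.pi) := ⟨Real.two_pi_pos⟩

lemma monomial_homeomorphCircle' (n : ℤ) (x : AddCircle (2 * Real.pi)) :
    monomial n (AddCircle.homeomorphCircle' x) = fourier n x := by
  induction x using QuotientAddGroup.induction_on with | _ x
  have h : ((AddCircle.homeomorphCircle' (x : AddCircle (2 * Real.pi)) : Circle)) =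
    Circle.exp x := AddCircle.homeomorphCircle'_apply_mk x
  have h2 : (fourier n (x : AddCircle (2 * Real.pi)) : ℂ) = _ := fourier_coe_apply
  refine Eq.trans ?_ h2.symm
  rw [monomial_apply, h, Circle.coe_exp, ← Complex.exp_int_mul]
  congr 1
  push_cast
  field_simp

lemma coeff_eq_fourierCoeff (f : Circle → ℂ) (n : ℤ) :
    coeff f n = fourierCoeff (f ∘ AddCircle.homeomorphCircle') n := by
  rw [fourierCoeff_eq_intervalIntegral _ _ 0, coeff, zero_add, Complex.real_smul]
  push_cast
  congr 1
  refine intervalIntegral.integral_congr fun x _ => ?_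
  simp only [Function.comp_apply, smul_eq_mul]
  rw [AddCircle.homeomorphCircle'_apply_mk, fourier_coe_apply, mul_comm]
  congr 2
  push_cast
  field_simp

/-- Uniform convergence of the Fourier series, transported from the additive circle along
`AddCircle.homeomorphCircle'`. -/
lemma hasSum_coeff_smul_monomial (f : C(Circle, ℂ)) (hf : Summable fun n => ‖coeff f n‖) :
    HasSum (fun n => coeff f n • monomial n) f := by
  set F : C(AddCircle (2 * Real.pi), ℂ) :=
    f.comp (AddCircle.homeomorphCircle' : C(AddCircle (2 * Real.pi), Circle)) with hF
  have h1 : ∀ n, coeff f n = fourierCoeff F n := fun n => coeff_eq_fourierCoeff f n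
  have h2 : HasSum (fun n => fourierCoeff F n • fourier n) F :=
    hasSum_fourier_series_of_summable (Summable.of_norm (by simpa only [h1] using hf))
  have h3 := h2.map (ContinuousMap.compRightAlgHom ℂ ℂ
    (AddCircle.homeomorphCircle'.symm : C(Circle, AddCircle (2 * Real.pi))))
    (ContinuousMap.continuous_precomp _)
  convert h3 using 1
  · ext n t
    have := monomial_homeomorphCircle' n (AddCircle.homeomorphCircle'.symm t)
    rw [Homeomorph.apply_symm_apply] at this
    simp only [Function.comp_apply, ContinuousMap.smul_apply, h1, this, map_smul]
    rfl
  · ext t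
    simp [hF]

lemma coeff_add {f g : Circle → ℂ} (hf : Continuous f) (hg : Continuous g) (n : ℤ) :
    coeff (f + g) n = coeff f n + coeff g n := by
  simp only [coeff, Pi.add_apply, add_mul]
  rw [intervalIntegral.integral_add, mul_add] <;>
    exact Continuous.intervalIntegrable (by fun_prop) _ _

lemma coeff_smul (z : ℂ) (f : Circle → ℂ) (n : ℤ) : coeff (z • f) n = z * coeff f n := by
  simp only [coeff, Pi.smul_apply, smul_eq_mul, mul_assoc, intervalIntegral.integral_const_mul]
  ring

lemma norm_coeff_le (f : C(Circle, ℂ)) (n : ℤ) : ‖coeff f n‖ ≤ ‖f‖ := by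
  have h : ‖∫ θ in (0 : ℝ)..(2 * Real.pi), f (Circle.exp θ) * Complex.exp (-Complex.I * n * θ)‖ ≤
      ‖f‖ * |2 * Real.pi - 0| := by
    refine intervalIntegral.norm_integral_le_of_norm_le_const fun x _ => ?_
    have : ‖Complex.exp (-Complex.I * n * x)‖ = 1 := by simp [Complex.norm_exp]
    rw [norm_mul, this, mul_one]
    exact f.norm_coe_le_norm _
  rw [sub_zero, abs_of_pos Real.two_pi_pos] at h
  rw [coeff, norm_mul]
  have h2 : ‖1 / (2 * (Real.pi : ℂ))‖ = 1 / (2 * Real.pi) := by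
    simp [abs_of_pos Real.pi_pos]
  rw [h2, one_div_mul_eq_div, div_le_iff₀ Real.two_pi_pos]
  exact h

/-- The Fourier coefficient as a continuous linear functional. -/
def coeffCLM (n : ℤ) : C(Circle, ℂ) →L[ℂ] ℂ :=
  LinearMap.mkContinuous
    { toFun := fun f => coeff f n
      map_add' := fun f g => coeff_add f.continuous g.continuous n
      map_smul' := fun z f => coeff_smul z f n } 1
    fun f => by simpa using norm_coeff_le f n

@[simp] lemma coeffCLM_apply (n : ℤ) (f : C(Circle, ℂ)) : coeffCLM n f = coeff f n := rfl

lemma coeff_monomial_mul (j : ℤ) (g : Circle → ℂ) (n : ℤ) :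
    coeff (monomial j * g) n = coeff g (n - j) := by
  rw [coeff, coeff]
  congr 1
  refine intervalIntegral.integral_congr fun x _ => ?_
  simp only [Pi.mul_apply, monomial_apply, Circle.coe_exp, ← Complex.exp_int_mul]
  rw [mul_comm (Complex.exp _), mul_assoc, ← Complex.exp_add]
  congr 2
  push_cast
  ring

lemma coeff_one (n : ℤ) : coeff 1 n = if n = 0 then 1 else 0 := by
  split_ifs with h
  · subst h
    simp [coeff]
    field_simp
  · simp only [coeff, Pi.one_apply, one_mul]
    have hc : -Complex.I * n ≠ 0 := by simp [h]
    rw [integral_exp_mul_complex hc]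
    have : -Complex.I * n * ((2 * Real.pi : ℝ) : ℂ) = (-n : ℤ) * (2 * Real.pi * Complex.I) := by
      push_cast
      ring
    rw [this, Complex.exp_int_mul_two_pi_mul_I]
    simp

lemma coeff_monomial (j n : ℤ) : coeff (monomial j) n = if n = j then 1 else 0 := by
  have := coeff_monomial_mul j 1 n
  rw [mul_one, coeff_one] at this
  simpa [sub_eq_zero] using this

lemma summable_smul_monomial {c : ℤ → ℂ} (hc : Summable fun n => ‖c n‖) :
    Summable fun n => c n • monomial n := by
  refine Summable.of_norm_bounded hc fun n => ?_
  rw [norm_smul]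
  exact mul_le_of_le_one_right (norm_nonneg _) (norm_monomial_le n)

/-- The function with the given absolutely summable Fourier coefficients. -/
def synth (c : ℤ → ℂ) : C(Circle, ℂ) := ∑' n, c n • monomial n

lemma coeff_synth {c : ℤ → ℂ} (hc : Summable fun n => ‖c n‖) (n : ℤ) : coeff (synth c) n = c n := by
  have h := (coeffCLM n).hasSum (summable_smul_monomial hc).hasSum
  have h2 : HasSum (fun j => coeffCLM n (c j • monomial j)) (c n) := by
    convert hasSum_single n ?_ using 1
    · simp [coeff_monomial]
    · intro j hj
      simp [coeff_monomial, hj.symm]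
  exact h.unique h2

lemma synth_apply {c : ℤ → ℂ} (hc : Summable fun n => ‖c n‖) (t : Circle) :
    HasSum (fun n => c n * (t : ℂ) ^ n) (synth c t) :=
  (ContinuousMap.evalCLM ℂ t).hasSum (summable_smul_monomial hc).hasSum

lemma synth_coeff (f : C(Circle, ℂ)) (hf : Summable fun n => ‖coeff f n‖) :
    synth (coeff f) = f := (hasSum_coeff_smul_monomial f hf).tsum_eq

lemma hasSum_coeff_mul_zpow {f : Circle → ℂ} (hf : Continuous f)
    (hs : Summable fun n => ‖coeff f n‖) (t : Circle) :
    HasSum (fun n => coeff f n * (t : ℂ) ^ n) (f t) := by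
  have := synth_apply hs t
  rwa [show synth (coeff f) = ⟨f, hf⟩ from synth_coeff ⟨f, hf⟩ hs] at this

/-- Multiply the uniformly convergent series of `f` by `g` and apply the continuous functional
`coeffCLM n` termwise: each monomial only shifts the coefficients of `g`. Summability is therefore
needed for `f` alone. -/
lemma coeff_mul {f g : Circle → ℂ} (hf : Continuous f) (hg : Continuous g)
    (hs : Summable fun n => ‖coeff f n‖) (n : ℤ) :
    coeff (f * g) n = conv (coeff f) (coeff g) n := by
  have h1 := (hasSum_coeff_smul_monomial ⟨f, hf⟩ hs).mul_right (⟨g, hg⟩ : C(Circle, ℂ))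
  have h2 := (coeffCLM n).hasSum h1
  refine h2.tsum_eq.symm.trans (tsum_congr fun j => ?_)
  rw [smul_mul_assoc, map_smul, coeffCLM_apply, smul_eq_mul]
  congr 1
  exact coeff_monomial_mul j g n

/-- Trigonometric polynomials are uniformly dense. -/
lemma exists_norm_sub_sum_lt (f : C(Circle, ℂ)) {ε : ℝ} (hε : 0 < ε) :
    ∃ p ∈ Submodule.span ℂ (Set.range monomial), ‖f - p‖ < ε := by
  set e : C(Circle, AddCircle (2 * Real.pi)) :=
    (AddCircle.homeomorphCircle'.symm : C(Circle, AddCircle (2 * Real.pi))) with he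
  set F : C(AddCircle (2 * Real.pi), ℂ) :=
    f.comp (AddCircle.homeomorphCircle' : C(AddCircle (2 * Real.pi), Circle)) with hF
  have h1 : F ∈ (Submodule.span ℂ (Set.range (@fourier (2 * Real.pi)))).topologicalClosure := by
    rw [span_fourier_closure_eq_top]
    trivial
  obtain ⟨q, hq, hqF⟩ := Metric.mem_closure_iff.1 h1 ε hε
  refine ⟨(ContinuousMap.compRightAlgHom ℂ ℂ e).toLinearMap q, ?_, ?_⟩
  · have h2 := Submodule.mem_map_of_mem (f := (ContinuousMap.compRightAlgHom ℂ ℂ e).toLinearMap) hq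
    rw [Submodule.map_span] at h2
    refine Submodule.span_mono ?_ h2
    rintro _ ⟨_, ⟨n, rfl⟩, rfl⟩
    refine ⟨n, ?_⟩
    ext t
    have := monomial_homeomorphCircle' n (AddCircle.homeomorphCircle'.symm t)
    rwa [Homeomorph.apply_symm_apply] at this
  · refine lt_of_le_of_lt ((ContinuousMap.norm_le _ dist_nonneg).2 fun t => ?_) hqF
    have := ContinuousMap.dist_apply_le_dist (f := F) (g := q) (e t)
    rw [dist_eq_norm] at this
    have h2 : F (e t) = f t := congr_arg f (AddCircle.homeomorphCircle'.apply_symm_apply t)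
    rw [h2] at this
    exact this

/-! ### Banach algebras -/

section Banach

variable {B : Type*} [NormedCommRing B] [NormedAlgebra ℂ B] [CompleteSpace B]

/-- Characters of a Banach algebra are automatically continuous, hence pass through convergent power
series. -/
lemma exists_algHom_hasSum {c : ℕ → ℂ} {f : B} (hf : Summable fun n => c n • f ^ n) :
    ∃ g : B, ∀ χ : B →ₐ[ℂ] ℂ, HasSum (fun n => c n * χ f ^ n) (χ g) := by
  refine ⟨∑' n, c n • f ^ n, fun χ => ?_⟩
  have := hf.hasSum.map χ (map_continuous χ)
  convert this using 1
  ext n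
  simp

lemma exists_algHom_eq_exp (f : B) : ∃ g : B, ∀ χ : B →ₐ[ℂ] ℂ, χ g = Complex.exp (χ f) := by
  obtain ⟨g, hg⟩ := exists_algHom_hasSum (NormedSpace.expSeries_summable' (𝕂 := ℂ) f)
  refine ⟨g, fun χ => (hg χ).unique ?_⟩
  rw [Complex.exp_eq_exp_ℂ]
  exact NormedSpace.exp_series_hasSum_exp' (𝕂 := ℂ) (χ f)

/-- By Gelfand theory the spectrum consists of the character values, so the spectral radius is at
most `q`; Gelfand's formula turns this into decay of the powers. -/
lemma exists_norm_pow_le {f : B} {q : ℝ} (hq : 0 ≤ q) (hf : ∀ χ : B →ₐ[ℂ] ℂ, ‖χ f‖ ≤ q) {q' : ℝ}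
    (hqq : q < q') : ∀ᶠ n : ℕ in Filter.atTop, ‖f ^ n‖ ≤ q' ^ n := by
  have hr : spectralRadius ℂ f < ENNReal.ofReal q' := by
    refine lt_of_le_of_lt (iSup₂_le fun z hz => ?_)
      ((ENNReal.ofReal_lt_ofReal_iff (hq.trans_lt hqq)).2 hqq)
    obtain ⟨χ, rfl⟩ := WeakDual.CharacterSpace.mem_spectrum_iff_exists.1 hz
    have := hf (WeakDual.CharacterSpace.equivAlgHom χ)
    exact ENNReal.coe_le_coe.2 (NNReal.le_toNNReal_of_coe_le this)
  have h1 := (spectrum.pow_norm_pow_one_div_tendsto_nhds_spectralRadius f).eventually_lt_const hr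
  filter_upwards [h1, Filter.eventually_gt_atTop 0] with n hn hn0
  rw [ENNReal.ofReal_lt_ofReal_iff (hq.trans_lt hqq)] at hn
  have h2 := pow_le_pow_left₀ (by positivity) hn.le n
  rwa [one_div, Real.rpow_inv_natCast_pow (norm_nonneg _) hn0.ne'] at h2

lemma exists_algHom_exp_eq {f : B} {q : ℝ} (hq : 0 ≤ q) (hq1 : q < 1)
    (hf : ∀ χ : B →ₐ[ℂ] ℂ, ‖χ f‖ ≤ q) :
    ∃ g : B, ∀ χ : B →ₐ[ℂ] ℂ, Complex.exp (χ g) = 1 - χ f := by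
  obtain ⟨q', hqq, hq'⟩ := exists_between hq1
  -- This is the series of `-log (1 - f)`; its term at `n = 0` vanishes because `1 / 0 = 0`. It
  -- converges although `‖f‖` itself may exceed one.
  have hs : Summable fun n : ℕ => (1 / (n : ℂ)) • f ^ n := by
    refine Summable.of_norm_bounded_eventually_nat
      (summable_geometric_of_lt_one (hq.trans hqq.le) hq') ?_
    filter_upwards [exists_norm_pow_le hq hf hqq] with n hn
    rw [norm_smul]
    refine (mul_le_of_le_one_left (norm_nonneg _) ?_).trans hn
    rw [norm_div, norm_one, Complex.norm_natCast]
    rcases Nat.eq_zero_or_pos n with rfl | hn0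
    · simp
    · exact (div_le_one (by exact_mod_cast hn0)).2 (by exact_mod_cast hn0)
  obtain ⟨g, hg⟩ := exists_algHom_hasSum hs
  refine ⟨-g, fun χ => ?_⟩
  have h1 : ‖χ f‖ < 1 := (hf χ).trans_lt hq1
  have h2 := Complex.hasSum_taylorSeries_neg_log h1
  have h3 : χ g = -Complex.log (1 - χ f) := by
    refine (hg χ).unique ?_
    convert h2 using 2
    ring
  rw [map_neg, h3, neg_neg, Complex.exp_log]
  intro h0
  rw [sub_eq_zero] at h0
  simp [← h0] at h1

end Banach

/-! ### Consequences of a complete algebra norm -/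

namespace IsBanachAlgebraNorm

variable {A : Type} [CommRing A] [Algebra ℂ A] {N : A → ℝ}

/-- A commutative ring with a complete algebra norm as a normed ring. -/
@[reducible] def normedCommRing (h : IsBanachAlgebraNorm A N) : NormedCommRing A :=
  -- Scaling by the constant of the product estimate makes the norm submultiplicative.
  letI : Norm A := ⟨fun f => h.mul_le.choose * N f⟩
  { NormedAddCommGroup.ofCore (𝕜 := ℂ) (E := A)
      { norm_nonneg := fun f => mul_nonneg h.mul_le.choose_spec.1.le (h.nonneg f)
        norm_smul := fun z f => by
          change _ * N (z • f) = ‖z‖ * (_ * N f)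
          rw [h.smul]
          ring
        norm_triangle := fun f g => by
          change _ * N (f + g) ≤ _ * N f + _ * N g
          rw [← mul_add]
          exact mul_le_mul_of_nonneg_left (h.add_le f g) h.mul_le.choose_spec.1.le
        norm_eq_zero_iff := fun f => by
          change _ * N f = 0 ↔ f = 0
          rw [mul_eq_zero, or_iff_right h.mul_le.choose_spec.1.ne', h.eq_zero_iff] },
    (inferInstance : CommRing A) with
    norm_mul_le := fun f g => by
      change _ * N (f * g) ≤ (_ * N f) * (_ * N g)
      have := mul_le_mul_of_nonneg_left (h.mul_le.choose_spec.2 f g) h.mul_le.choose_spec.1.le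
      refine this.trans (le_of_eq ?_)
      ring }

lemma norm_eq (h : IsBanachAlgebraNorm A N) (f : A) :
    @norm A h.normedCommRing.toNorm f = h.mul_le.choose * N f := rfl

/-- The normed algebra structure over `normedCommRing`. -/
@[reducible] def normedAlgebra (h : IsBanachAlgebraNorm A N) :
    @NormedAlgebra ℂ A _ h.normedCommRing.toSeminormedCommRing.toSeminormedRing :=
  letI := h.normedCommRing
  { (inferInstance : Algebra ℂ A) with
    norm_smul_le := fun z f => by
      change _ * N (z • f) ≤ ‖z‖ * (_ * N f)
      rw [h.smul]
      exact le_of_eq (by ring) }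

lemma completeSpace (h : IsBanachAlgebraNorm A N) :
    @CompleteSpace A h.normedCommRing.toPseudoMetricSpace.toUniformSpace := by
  let := h.normedCommRing
  have hC := h.mul_le.choose_spec.1
  refine Metric.complete_of_cauchySeq_tendsto fun u hu => ?_
  rw [Metric.cauchySeq_iff] at hu
  obtain ⟨f, hf⟩ := h.complete u fun ε hε => by
    obtain ⟨k, hk⟩ := hu (h.mul_le.choose * ε) (by positivity)
    refine ⟨k, fun m hm n hn => ?_⟩
    have := hk m hm n hn
    rw [dist_eq_norm, h.norm_eq] at this
    exact lt_of_mul_lt_mul_left this hC.le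
  refine ⟨f, tendsto_iff_norm_sub_tendsto_zero.2 ?_⟩
  simpa [h.norm_eq] using hf.const_mul h.mul_le.choose

/-- Characters are automatically bounded. -/
lemma exists_norm_algHom_le (h : IsBanachAlgebraNorm A N) :
    ∃ K, ∀ (χ : A →ₐ[ℂ] ℂ) (f : A), ‖χ f‖ ≤ K * N f := by
  let := h.normedCommRing
  let := h.normedAlgebra
  have := h.completeSpace
  refine ⟨h.mul_le.choose * ‖(1 : A)‖, fun χ f => ?_⟩
  refine (AlgHom.norm_apply_le_self_mul_norm_one χ f).trans (le_of_eq ?_)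
  rw [h.norm_eq f]
  ring

/-- Every maximal ideal is the kernel of a character. -/
lemma exists_eq_ker (h : IsBanachAlgebraNorm A N) (J : Ideal A) (hJ : J.IsMaximal) :
    ∃ χ : A →ₐ[ℂ] ℂ, J = RingHom.ker χ := by
  let := h.normedCommRing
  let := h.normedAlgebra
  have := h.completeSpace
  refine ⟨WeakDual.CharacterSpace.equivAlgHom J.toCharacterSpace, ?_⟩
  refine hJ.eq_of_le (RingHom.ker_ne_top _) fun f hf => ?_
  exact J.toCharacterSpace_apply_eq_zero_of_mem hf

lemma exists_algHom_eq_exp (h : IsBanachAlgebraNorm A N) (f : A) :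
    ∃ g : A, ∀ χ : A →ₐ[ℂ] ℂ, χ g = Complex.exp (χ f) := by
  let := h.normedCommRing
  let := h.normedAlgebra
  have := h.completeSpace
  exact OrliczWiener.exists_algHom_eq_exp f

lemma exists_algHom_exp_eq (h : IsBanachAlgebraNorm A N) {f : A} {q : ℝ} (hq : 0 ≤ q)
    (hq1 : q < 1) (hf : ∀ χ : A →ₐ[ℂ] ℂ, ‖χ f‖ ≤ q) :
    ∃ g : A, ∀ χ : A →ₐ[ℂ] ℂ, Complex.exp (χ g) = 1 - χ f := by
  let := h.normedCommRing
  let := h.normedAlgebra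
  have := h.completeSpace
  exact OrliczWiener.exists_algHom_exp_eq hq hq1 hf

/-- If the algebra norm satisfies a differential-norm inequality with respect to a submultiplicative
quantity `W`, then every character is bounded by `W`. -/
lemma norm_algHom_le (h : IsBanachAlgebraNorm A N) {W : A → ℝ} (hW : ∀ f, 0 ≤ W f)
    (hWmul : ∀ f g, W (f * g) ≤ W f * W g) {K : ℝ} (hK : 0 ≤ K)
    (hsq : ∀ f, N (f * f) ≤ K * W f * N f) (χ : A →ₐ[ℂ] ℂ) (f : A) : ‖χ f‖ ≤ W f := by
  obtain ⟨M, hM⟩ := h.exists_norm_algHom_le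
  have hWpow : ∀ (f : A) (k : ℕ), W (f ^ 2 ^ k) ≤ W f ^ 2 ^ k := by
    intro f k
    induction k with
    | zero => simp
    | succ k ih =>
      rw [pow_succ, pow_mul, pow_mul, sq, sq]
      exact (hWmul _ _).trans (mul_le_mul ih ih (hW _) (pow_nonneg (hW _) _))
  -- The extra factor `W f` on the left replaces the exponent `2 ^ k - 1` by `2 ^ k`.
  have hN : ∀ k : ℕ, W f * N (f ^ 2 ^ k) ≤ K ^ k * W f ^ 2 ^ k * N f := by
    intro k
    induction k with
    | zero => simp
    | succ k ih =>
      have h1 : f ^ 2 ^ (k + 1) = f ^ 2 ^ k * f ^ 2 ^ k := by rw [pow_succ, pow_mul, sq]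
      have h2 : W f ^ 2 ^ (k + 1) = W f ^ 2 ^ k * W f ^ 2 ^ k := by rw [pow_succ, pow_mul, sq]
      rw [h1, h2]
      calc W f * N (f ^ 2 ^ k * f ^ 2 ^ k) ≤ W f * (K * W f ^ 2 ^ k * N (f ^ 2 ^ k)) := by
            refine mul_le_mul_of_nonneg_left ((hsq _).trans ?_) (hW f)
            have := h.nonneg (f ^ 2 ^ k)
            gcongr
            exact hWpow f k
        _ = K * W f ^ 2 ^ k * (W f * N (f ^ 2 ^ k)) := by ring
        _ ≤ K * W f ^ 2 ^ k * (K ^ k * W f ^ 2 ^ k * N f) :=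
            mul_le_mul_of_nonneg_left ih (mul_nonneg hK (pow_nonneg (hW f) _))
        _ = K ^ (k + 1) * (W f ^ 2 ^ k * W f ^ 2 ^ k) * N f := by ring
  by_contra! hlt
  have hNsq : N (f * f) ≤ K * W f * N f := hsq f
  -- If `W f = 0`, the inequality for squares gives `f * f = 0`, so `χ f = 0`, against `W f < ‖χ
  -- f‖`.
  have hy : 0 < W f := by
    refine (hW f).lt_of_ne fun h0 => ?_
    rw [← h0, mul_zero, zero_mul] at hNsq
    have h1 : χ (f * f) = 0 := by
      rw [(h.eq_zero_iff _).1 (le_antisymm hNsq (h.nonneg _)), map_zero]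
    have h2 : χ f = 0 := by simpa using h1
    rw [h2, norm_zero, ← h0] at hlt
    exact lt_irrefl _ hlt
  -- With `K < 2 ^ L`, the factor `K ^ k` is at most `m ^ L` for `m = 2 ^ k`, and this loses against
  -- `q ^ m` since `q > 1`.
  obtain ⟨L, hL⟩ := pow_unbounded_of_one_lt K one_lt_two
  set q := ‖χ f‖ / W f
  have hq : 1 < q := (one_lt_div hy).2 hlt
  set D := |M| * N f / W f
  have hN0 := h.nonneg f
  have key : ∀ k : ℕ, 1 ≤ D * (((2 ^ k : ℕ) : ℝ) ^ L / q ^ 2 ^ k) := by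
    intro k
    have h1 : ‖χ f‖ ^ 2 ^ k ≤ |M| * N (f ^ 2 ^ k) := by
      rw [← norm_pow, ← map_pow]
      exact (hM χ _).trans (mul_le_mul_of_nonneg_right (le_abs_self M) (h.nonneg _))
    have h2 : K ^ k ≤ ((2 ^ k : ℕ) : ℝ) ^ L := by
      push_cast
      rw [← pow_mul, mul_comm k L, pow_mul]
      exact pow_le_pow_left₀ hK hL.le k
    rw [← mul_div_assoc, one_le_div (by positivity), div_pow, div_le_iff₀ (by positivity)]
    calc ‖χ f‖ ^ 2 ^ k ≤ |M| * N (f ^ 2 ^ k) := h1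
      _ = |M| / W f * (W f * N (f ^ 2 ^ k)) := by field_simp
      _ ≤ |M| / W f * (K ^ k * W f ^ 2 ^ k * N f) :=
          mul_le_mul_of_nonneg_left (hN k) (by positivity)
      _ ≤ |M| / W f * (((2 ^ k : ℕ) : ℝ) ^ L * W f ^ 2 ^ k * N f) := by gcongr
      _ = D * ((2 ^ k : ℕ) : ℝ) ^ L * W f ^ 2 ^ k := by ring
  have hlim := ((tendsto_pow_const_div_const_pow_of_one_lt L hq).comp
    (tendsto_pow_atTop_atTop_of_one_lt (one_lt_two (α := ℕ)))).const_mul D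
  have := ge_of_tendsto hlim (.of_forall key)
  norm_num at this

end IsBanachAlgebraNorm

/-! ### The space of Fourier coefficients -/

/-- The standing assumptions on the Orlicz functions and the weights. -/
structure IsAdmissible (Φ Ψ : ℝ → ℝ) (φ w : ℕ+ → ℝ) (ψ ρ : ℕ → ℝ) : Prop where
  Φ : IsOrliczFunction Φ
  Ψ : IsOrliczFunction Ψ
  φ : IsWeightMinus φ
  w : IsWeightMinus w
  ψ : IsWeightPlus ψ
  ρ : IsWeightPlus ρ

/-- The coefficient sequences of the elements of `wienerOrlicz`. -/
structure MemCoeff (Φ Ψ : ℝ → ℝ) (φ w : ℕ+ → ℝ) (ψ ρ : ℕ → ℝ) (c : ℤ → ℂ) : Prop where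
  summable : Summable fun n => ‖c n‖
  minus : MemOrlicz Φ φ w fun n : ℕ+ => c (-(n : ℤ))
  plus : MemOrlicz Ψ ψ ρ fun n : ℕ => c (n : ℤ)

/-- The norm of `wienerOrlicz` in terms of the coefficient sequence. -/
def coeffNorm (Φ Ψ : ℝ → ℝ) (φ w : ℕ+ → ℝ) (ψ ρ : ℕ → ℝ) (c : ℤ → ℂ) : ℝ :=
  (∑' n : ℤ, ‖c n‖) + orliczNorm Φ φ w (fun n : ℕ+ => c (-(n : ℤ))) +
    orliczNorm Ψ ψ ρ (fun n : ℕ => c (n : ℤ))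

variable {Φ Ψ : ℝ → ℝ} {φ w : ℕ+ → ℝ} {ψ ρ : ℕ → ℝ}

lemma mem_wienerOrlicz_iff {f : Circle → ℂ} : f ∈ wienerOrlicz Φ Ψ φ w ψ ρ ↔
    Continuous f ∧ MemCoeff Φ Ψ φ w ψ ρ (coeff f) :=
  ⟨fun ⟨h1, h2, h3, h4⟩ => ⟨h1, h2, h3, h4⟩, fun ⟨h1, h2, h3, h4⟩ => ⟨h1, h2, h3, h4⟩⟩

lemma wienerOrliczNorm_eq (f : Circle → ℂ) :
    wienerOrliczNorm Φ Ψ φ w ψ ρ f = coeffNorm Φ Ψ φ w ψ ρ (coeff f) := rfl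

lemma coeffNorm_nonneg (c : ℤ → ℂ) : 0 ≤ coeffNorm Φ Ψ φ w ψ ρ c :=
  add_nonneg (add_nonneg (tsum_nonneg fun _ => norm_nonneg _) (orliczNorm_nonneg _))
    (orliczNorm_nonneg _)

lemma tsum_norm_le_coeffNorm (c : ℤ → ℂ) : ∑' n, ‖c n‖ ≤ coeffNorm Φ Ψ φ w ψ ρ c := by
  rw [coeffNorm, add_assoc]
  exact le_add_of_nonneg_right (add_nonneg (orliczNorm_nonneg _) (orliczNorm_nonneg _))

lemma orliczNorm_minus_le_coeffNorm (c : ℤ → ℂ) :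
    orliczNorm Φ φ w (fun n : ℕ+ => c (-(n : ℤ))) ≤ coeffNorm Φ Ψ φ w ψ ρ c := by
  rw [coeffNorm, add_right_comm]
  exact le_add_of_nonneg_left (add_nonneg (tsum_nonneg fun _ => norm_nonneg _)
    (orliczNorm_nonneg _))

lemma orliczNorm_plus_le_coeffNorm (c : ℤ → ℂ) :
    orliczNorm Ψ ψ ρ (fun n : ℕ => c (n : ℤ)) ≤ coeffNorm Φ Ψ φ w ψ ρ c :=
  le_add_of_nonneg_left (add_nonneg (tsum_nonneg fun _ => norm_nonneg _) (orliczNorm_nonneg _))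

/-- The shear `(n, j) ↦ (j, n - j)` turns the double sum into a product of two sums. -/
lemma hasSum_norm_conv_bound {f g : ℤ → ℂ} (hf : Summable fun n => ‖f n‖)
    (hg : Summable fun n => ‖g n‖) :
    HasSum (fun n => ∑' j, ‖f j‖ * ‖g (n - j)‖) ((∑' n, ‖f n‖) * ∑' n, ‖g n‖) := by
  let e : ℤ × ℤ ≃ ℤ × ℤ :=
    { toFun := fun p => (p.2, p.1 - p.2)
      invFun := fun p => (p.1 + p.2, p.1)
      left_inv := fun p => by simp
      right_inv := fun p => by simp }
  have h1 : Summable fun p : ℤ × ℤ => ‖f p.1‖ * ‖g p.2‖ :=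
    hf.mul_of_nonneg hg (fun _ => norm_nonneg _) fun _ => norm_nonneg _
  have h2 : HasSum (fun p : ℤ × ℤ => ‖f p.2‖ * ‖g (p.1 - p.2)‖)
      ((∑' n, ‖f n‖) * ∑' n, ‖g n‖) := by
    rw [hf.tsum_mul_tsum hg h1]
    exact e.hasSum_iff.2 h1.hasSum
  exact h2.prod_fiberwise fun n => (h2.summable.prod_factor n).hasSum

lemma norm_conv_le {f g : ℤ → ℂ} (hf : Summable fun n => ‖f n‖) (hg : Summable fun n => ‖g n‖)
    (n : ℤ) : ‖conv f g n‖ ≤ ∑' j, ‖f j‖ * ‖g (n - j)‖ := by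
  have := (summable_mul_sub hf hg n).norm
  refine (norm_tsum_le_tsum_norm this).trans (le_of_eq ?_)
  simp_rw [norm_mul]

lemma summable_norm_conv {f g : ℤ → ℂ} (hf : Summable fun n => ‖f n‖)
    (hg : Summable fun n => ‖g n‖) : Summable fun n => ‖conv f g n‖ :=
  (hasSum_norm_conv_bound hf hg).summable.of_nonneg_of_le (fun _ => norm_nonneg _)
    (norm_conv_le hf hg)

lemma tsum_norm_conv_le {f g : ℤ → ℂ} (hf : Summable fun n => ‖f n‖)
    (hg : Summable fun n => ‖g n‖) :
    ∑' n, ‖conv f g n‖ ≤ (∑' n, ‖f n‖) * ∑' n, ‖g n‖ :=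
  hasSum_le (norm_conv_le hf hg) (summable_norm_conv hf hg).hasSum (hasSum_norm_conv_bound hf hg)

lemma neg_pnat_injective : Function.Injective fun n : ℕ+ => -(n : ℤ) := fun m n h => by
  simpa using h

/-! ### Closure properties of the coefficient space -/

namespace MemCoeff

lemma add (h : IsAdmissible Φ Ψ φ w ψ ρ) {c d : ℤ → ℂ} (hc : MemCoeff Φ Ψ φ w ψ ρ c)
    (hd : MemCoeff Φ Ψ φ w ψ ρ d) : MemCoeff Φ Ψ φ w ψ ρ (c + d) where
  summable := (hc.summable.add hd.summable).of_nonneg_of_le (fun _ => norm_nonneg _)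
    fun _ => norm_add_le _ _
  minus := hc.minus.add h.Φ h.φ.pos h.w.pos hd.minus
  plus := hc.plus.add h.Ψ h.ψ.pos h.ρ.pos hd.plus

lemma smul (h : IsAdmissible Φ Ψ φ w ψ ρ) (z : ℂ) {c : ℤ → ℂ} (hc : MemCoeff Φ Ψ φ w ψ ρ c) :
    MemCoeff Φ Ψ φ w ψ ρ (z • c) where
  summable := by simpa [norm_smul] using hc.summable.mul_left ‖z‖
  minus := hc.minus.smul h.Φ z
  plus := hc.plus.smul h.Ψ z

lemma sub (h : IsAdmissible Φ Ψ φ w ψ ρ) {c d : ℤ → ℂ} (hc : MemCoeff Φ Ψ φ w ψ ρ c)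
    (hd : MemCoeff Φ Ψ φ w ψ ρ d) : MemCoeff Φ Ψ φ w ψ ρ (c - d) := by
  have := hc.add h (hd.smul h (-1))
  rwa [neg_one_smul, ← sub_eq_add_neg] at this

/-- Solidity of the space; it permits discarding frequencies in the factorization. -/
lemma of_norm_le (h : IsAdmissible Φ Ψ φ w ψ ρ) {c d : ℤ → ℂ} (hd : MemCoeff Φ Ψ φ w ψ ρ d)
    (hcd : ∀ n, ‖c n‖ ≤ ‖d n‖) : MemCoeff Φ Ψ φ w ψ ρ c where
  summable := hd.summable.of_nonneg_of_le (fun _ => norm_nonneg _) hcd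
  minus := hd.minus.of_norm_le h.Φ h.φ.pos h.w.pos fun _ => hcd _
  plus := hd.plus.of_norm_le h.Ψ h.ψ.pos h.ρ.pos fun _ => hcd _

lemma of_finite_support (h : IsAdmissible Φ Ψ φ w ψ ρ) {c : ℤ → ℂ}
    (hc : (Function.support c).Finite) : MemCoeff Φ Ψ φ w ψ ρ c where
  summable := summable_of_hasFiniteSupport (hc.subset fun n hn => by simpa using hn)
  minus := memOrlicz_of_finite_support h.Φ (hc.preimage neg_pnat_injective.injOn)
  plus := memOrlicz_of_finite_support h.Ψ (hc.preimage Nat.cast_injective.injOn)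

lemma conv (h : IsAdmissible Φ Ψ φ w ψ ρ) {c d : ℤ → ℂ} (hc : MemCoeff Φ Ψ φ w ψ ρ c)
    (hd : MemCoeff Φ Ψ φ w ψ ρ d) : MemCoeff Φ Ψ φ w ψ ρ (conv c d) := by
  obtain ⟨C, hC, hC'⟩ := exists_isConvWeight_minus h.φ h.w
  obtain ⟨D, hD, hD'⟩ := exists_isConvWeight_plus h.ψ h.ρ
  exact ⟨summable_norm_conv hc.summable hd.summable,
    hc.minus.conv h.Φ h.φ.pos h.w.pos neg_pnat_injective hC hC' hc.summable hd.summable hd.minus,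
    hc.plus.conv h.Ψ h.ψ.pos h.ρ.pos Nat.cast_injective hD hD' hc.summable hd.summable hd.plus⟩

end MemCoeff

lemma coeffNorm_add_le (h : IsAdmissible Φ Ψ φ w ψ ρ) {c d : ℤ → ℂ}
    (hc : MemCoeff Φ Ψ φ w ψ ρ c) (hd : MemCoeff Φ Ψ φ w ψ ρ d) :
    coeffNorm Φ Ψ φ w ψ ρ (c + d) ≤ coeffNorm Φ Ψ φ w ψ ρ c + coeffNorm Φ Ψ φ w ψ ρ d := by
  have h1 : ∑' n, ‖(c + d) n‖ ≤ ∑' n, ‖c n‖ + ∑' n, ‖d n‖ := by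
    rw [← hc.summable.tsum_add hd.summable]
    exact (hc.add h hd).summable.tsum_le_tsum (fun _ => norm_add_le _ _)
      (hc.summable.add hd.summable)
  have h2 := orliczNorm_add_le h.Φ h.φ.pos h.w.pos hc.minus hd.minus
  have h3 := orliczNorm_add_le h.Ψ h.ψ.pos h.ρ.pos hc.plus hd.plus
  refine (add_le_add (add_le_add h1 h2) h3).trans (le_of_eq ?_)
  rw [coeffNorm, coeffNorm]
  ring

lemma coeffNorm_smul (h : IsAdmissible Φ Ψ φ w ψ ρ) (z : ℂ) {c : ℤ → ℂ}
    (hc : MemCoeff Φ Ψ φ w ψ ρ c) :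
    coeffNorm Φ Ψ φ w ψ ρ (z • c) = ‖z‖ * coeffNorm Φ Ψ φ w ψ ρ c := by
  have h2 := orliczNorm_smul h.Φ h.φ.pos h.w.pos z hc.minus
  have h3 := orliczNorm_smul h.Ψ h.ψ.pos h.ρ.pos z hc.plus
  have h1 : ∑' n, ‖(z • c) n‖ = ‖z‖ * ∑' n, ‖c n‖ := by
    rw [← tsum_mul_left]
    simp
  rw [coeffNorm, coeffNorm, mul_add, mul_add, ← h1, ← h2, ← h3]
  rfl

/-- The differential-norm inequality for convolutions. -/
lemma exists_coeffNorm_conv_le (h : IsAdmissible Φ Ψ φ w ψ ρ) :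
    ∃ K : ℝ, 0 < K ∧ ∀ c d : ℤ → ℂ, MemCoeff Φ Ψ φ w ψ ρ c → MemCoeff Φ Ψ φ w ψ ρ d →
      coeffNorm Φ Ψ φ w ψ ρ (conv c d) ≤
        K * ((∑' n, ‖d n‖) * coeffNorm Φ Ψ φ w ψ ρ c +
          (∑' n, ‖c n‖) * coeffNorm Φ Ψ φ w ψ ρ d) := by
  obtain ⟨C, hC, hC'⟩ := exists_isConvWeight_minus h.φ h.w
  obtain ⟨D, hD, hD'⟩ := exists_isConvWeight_plus h.ψ h.ρ
  -- The three summands serve the ℓ¹ part and the two Luxemburg norms.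
  refine ⟨1 + 2 * C ^ 2 + 2 * D ^ 2, by positivity, fun c d hc hd => ?_⟩
  have h1 := tsum_norm_conv_le hc.summable hd.summable
  have h2 := orliczNorm_conv_le h.Φ h.φ.pos h.w.pos neg_pnat_injective hC hC' hc.summable
    hd.summable hc.minus hd.minus
  have h3 := orliczNorm_conv_le h.Ψ h.ψ.pos h.ρ.pos Nat.cast_injective hD hD' hc.summable
    hd.summable hc.plus hd.plus
  have hF : 0 ≤ ∑' n, ‖c n‖ := tsum_nonneg fun _ => norm_nonneg _
  have hG : 0 ≤ ∑' n, ‖d n‖ := tsum_nonneg fun _ => norm_nonneg _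
  have hd0 := coeffNorm_nonneg (Φ := Φ) (Ψ := Ψ) (φ := φ) (w := w) (ψ := ψ) (ρ := ρ) d
  have hc0 := coeffNorm_nonneg (Φ := Φ) (Ψ := Ψ) (φ := φ) (w := w) (ψ := ψ) (ρ := ρ) c
  set S := (∑' n, ‖d n‖) * coeffNorm Φ Ψ φ w ψ ρ c + (∑' n, ‖c n‖) * coeffNorm Φ Ψ φ w ψ ρ d
  have e1 : (∑' n, ‖c n‖) * ∑' n, ‖d n‖ ≤ S := by
    refine le_add_of_nonneg_of_le (mul_nonneg hG hc0) ?_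
    exact mul_le_mul_of_nonneg_left (tsum_norm_le_coeffNorm d) hF
  have e2 : 2 * C ^ 2 * _ ≤ 2 * C ^ 2 * S := mul_le_mul_of_nonneg_left (add_le_add
    (mul_le_mul_of_nonneg_left (orliczNorm_minus_le_coeffNorm c) hG)
    (mul_le_mul_of_nonneg_left (orliczNorm_minus_le_coeffNorm d) hF)) (by positivity)
  have e3 : 2 * D ^ 2 * _ ≤ 2 * D ^ 2 * S := mul_le_mul_of_nonneg_left (add_le_add
    (mul_le_mul_of_nonneg_left (orliczNorm_plus_le_coeffNorm c) hG)
    (mul_le_mul_of_nonneg_left (orliczNorm_plus_le_coeffNorm d) hF)) (by positivity)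
  refine (add_le_add (add_le_add (h1.trans e1) (h2.trans e2)) (h3.trans e3)).trans (le_of_eq ?_)
  ring

lemma summable_and_tsum_le_of_tendsto {c : ℕ → ℤ → ℂ} {d : ℤ → ℂ}
    (hd : ∀ n, Filter.Tendsto (fun k => c k n) Filter.atTop (𝓝 (d n))) {ε : ℝ}
    (hε : ∀ᶠ k in Filter.atTop, Summable (fun n => ‖c k n‖) ∧ ∑' n, ‖c k n‖ ≤ ε) :
    Summable (fun n => ‖d n‖) ∧ ∑' n, ‖d n‖ ≤ ε := by
  have h1 : ∀ s : Finset ℤ, ∑ n ∈ s, ‖d n‖ ≤ ε := fun s =>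
    le_of_tendsto (tendsto_finsetSum s fun n _ => (hd n).norm)
      (hε.mono fun k hk => (hk.1.sum_le_tsum s fun _ _ => norm_nonneg _).trans hk.2)
  exact ⟨summable_of_sum_le (fun _ => norm_nonneg _) h1,
    Real.tsum_le_of_sum_le (fun _ => norm_nonneg _) h1⟩

/-- The ℓ¹ part yields a coefficientwise limit `d`. Letting `l → ∞` in `c m - c l`, lower
semicontinuity bounds each of the three parts of the norm of `c m - d` by `ε`. -/
lemma exists_coeffNorm_limit (h : IsAdmissible Φ Ψ φ w ψ ρ) {c : ℕ → ℤ → ℂ}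
    (hc : ∀ k, MemCoeff Φ Ψ φ w ψ ρ (c k))
    (hcauchy : ∀ ε : ℝ, 0 < ε → ∃ k, ∀ m, k ≤ m → ∀ n, k ≤ n →
      coeffNorm Φ Ψ φ w ψ ρ (c m - c n) < ε) :
    ∃ d, MemCoeff Φ Ψ φ w ψ ρ d ∧
      Filter.Tendsto (fun k => coeffNorm Φ Ψ φ w ψ ρ (c k - d)) Filter.atTop (𝓝 0) := by
  have hpt : ∀ n, ∃ z, Filter.Tendsto (fun k => c k n) Filter.atTop (𝓝 z) := by
    intro n
    refine cauchySeq_tendsto_of_complete (Metric.cauchySeq_iff.2 fun ε hε => ?_)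
    obtain ⟨k, hk⟩ := hcauchy ε hε
    refine ⟨k, fun l hl m hm => ?_⟩
    rw [dist_eq_norm]
    exact (((hc l).sub h (hc m)).summable.le_tsum n fun _ _ => norm_nonneg _).trans_lt
      ((tsum_norm_le_coeffNorm _).trans_lt (hk l hl m hm))
  choose d hd using hpt
  have key : ∀ ε : ℝ, 0 < ε → ∃ k, ∀ m, k ≤ m →
      MemCoeff Φ Ψ φ w ψ ρ (c m - d) ∧ coeffNorm Φ Ψ φ w ψ ρ (c m - d) ≤ 3 * ε := by
    intro ε hε
    obtain ⟨k, hk⟩ := hcauchy ε hε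
    refine ⟨k, fun m hm => ?_⟩
    have hlim : ∀ n, Filter.Tendsto (fun l => (c m - c l) n) Filter.atTop (𝓝 ((c m - d) n)) :=
      fun n => (hd n).const_sub (c m n)
    have hev := Filter.eventually_ge_atTop k
    have h1 := summable_and_tsum_le_of_tendsto hlim (ε := ε) (hev.mono fun l hl =>
      ⟨((hc m).sub h (hc l)).summable, (tsum_norm_le_coeffNorm _).trans (hk m hm l hl).le⟩)
    have h2 : modular Φ φ w (fun n : ℕ+ => (c m - d) (-(n : ℤ))) ε ≤ 1 :=
      modular_le_of_tendsto h.Φ h.φ.pos (fun n => hlim (-(n : ℤ))) hε (hev.mono fun l hl =>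
        ((hc m).sub h (hc l)).minus.modular_le_one h.Φ h.φ.pos h.w.pos
          ((orliczNorm_minus_le_coeffNorm _).trans_lt (hk m hm l hl)))
    have h3 : modular Ψ ψ ρ (fun n : ℕ => (c m - d) (n : ℤ)) ε ≤ 1 :=
      modular_le_of_tendsto h.Ψ h.ψ.pos (fun n => hlim (n : ℤ)) hε (hev.mono fun l hl =>
        ((hc m).sub h (hc l)).plus.modular_le_one h.Ψ h.ψ.pos h.ρ.pos
          ((orliczNorm_plus_le_coeffNorm _).trans_lt (hk m hm l hl)))
    refine ⟨⟨h1.1, (memOrlicz_iff h.Φ h.φ.pos h.w.pos).2 ⟨ε, hε, h2⟩,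
      (memOrlicz_iff h.Ψ h.ψ.pos h.ρ.pos).2 ⟨ε, hε, h3⟩⟩, ?_⟩
    have := add_le_add (add_le_add h1.2 (orliczNorm_le hε h2)) (orliczNorm_le hε h3)
    rw [coeffNorm]
    linarith
  refine ⟨d, ?_, ?_⟩
  -- `d = c k - (c k - d)` is a difference of two members.
  · obtain ⟨k, hk⟩ := key 1 one_pos
    simpa using (hc k).sub h (hk k le_rfl).1
  · refine Metric.tendsto_atTop.2 fun ε hε => ?_
    obtain ⟨k, hk⟩ := key (ε / 4) (by positivity)
    refine ⟨k, fun m hm => ?_⟩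
    rw [dist_zero_right, Real.norm_of_nonneg (coeffNorm_nonneg _)]
    linarith [(hk m hm).2]

/-! ### The algebra -/

lemma wienerOrlicz_add (h : IsAdmissible Φ Ψ φ w ψ ρ) {f g : Circle → ℂ}
    (hf : f ∈ wienerOrlicz Φ Ψ φ w ψ ρ) (hg : g ∈ wienerOrlicz Φ Ψ φ w ψ ρ) :
    f + g ∈ wienerOrlicz Φ Ψ φ w ψ ρ := by
  rw [mem_wienerOrlicz_iff] at *
  refine ⟨hf.1.add hg.1, ?_⟩
  rw [show coeff (f + g) = coeff f + coeff g from funext fun n => coeff_add hf.1 hg.1 n]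
  exact hf.2.add h hg.2

lemma wienerOrlicz_mul (h : IsAdmissible Φ Ψ φ w ψ ρ) {f g : Circle → ℂ}
    (hf : f ∈ wienerOrlicz Φ Ψ φ w ψ ρ) (hg : g ∈ wienerOrlicz Φ Ψ φ w ψ ρ) :
    f * g ∈ wienerOrlicz Φ Ψ φ w ψ ρ := by
  rw [mem_wienerOrlicz_iff] at *
  refine ⟨hf.1.mul hg.1, ?_⟩
  rw [show coeff (f * g) = conv (coeff f) (coeff g) from
    funext fun n => coeff_mul hf.1 hg.1 hf.2.summable n]
  exact hf.2.conv h hg.2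

lemma monomial_mem_wienerOrlicz (h : IsAdmissible Φ Ψ φ w ψ ρ) (n : ℤ) :
    ⇑(monomial n) ∈ wienerOrlicz Φ Ψ φ w ψ ρ := by
  rw [mem_wienerOrlicz_iff]
  refine ⟨(monomial n).continuous, .of_finite_support h ((Set.finite_singleton n).subset ?_)⟩
  intro j hj
  by_contra hne
  exact hj ((coeff_monomial n j).trans (if_neg hne))

lemma synth_mem_wienerOrlicz {c : ℤ → ℂ} (hc : MemCoeff Φ Ψ φ w ψ ρ c) :
    ⇑(synth c) ∈ wienerOrlicz Φ Ψ φ w ψ ρ := by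
  rw [mem_wienerOrlicz_iff, funext (coeff_synth hc.summable)]
  exact ⟨(synth c).continuous, hc⟩

lemma wienerOrlicz_smul (h : IsAdmissible Φ Ψ φ w ψ ρ) (z : ℂ) {f : Circle → ℂ}
    (hf : f ∈ wienerOrlicz Φ Ψ φ w ψ ρ) : z • f ∈ wienerOrlicz Φ Ψ φ w ψ ρ := by
  rw [mem_wienerOrlicz_iff] at *
  refine ⟨hf.1.const_smul z, ?_⟩
  rw [show coeff (z • f) = z • coeff f from funext fun n => coeff_smul z f n]
  exact hf.2.smul h z

/-- `wienerOrlicz` as a subalgebra of the functions on the circle. -/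
def wienerOrliczSubalgebra (h : IsAdmissible Φ Ψ φ w ψ ρ) : Subalgebra ℂ (Circle → ℂ) where
  carrier := wienerOrlicz Φ Ψ φ w ψ ρ
  mul_mem' := wienerOrlicz_mul h
  add_mem' := wienerOrlicz_add h
  algebraMap_mem' z := by
    rw [Algebra.algebraMap_eq_smul_one]
    refine wienerOrlicz_smul h z ?_
    have := monomial_mem_wienerOrlicz h 0
    rwa [monomial_zero] at this

section Subalgebra

variable (h : IsAdmissible Φ Ψ φ w ψ ρ)

lemma memCoeff_coe (f : wienerOrliczSubalgebra h) :
    MemCoeff Φ Ψ φ w ψ ρ (coeff (f : Circle → ℂ)) := (mem_wienerOrlicz_iff.1 f.2).2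

lemma continuous_coe (f : wienerOrliczSubalgebra h) : Continuous (f : Circle → ℂ) := f.2.1

lemma coeff_coe_add (f g : wienerOrliczSubalgebra h) :
    coeff ((f + g : wienerOrliczSubalgebra h) : Circle → ℂ) =
      coeff (f : Circle → ℂ) + coeff (g : Circle → ℂ) :=
  funext fun n => coeff_add (continuous_coe h f) (continuous_coe h g) n

lemma coeff_coe_smul (z : ℂ) (f : wienerOrliczSubalgebra h) :
    coeff ((z • f : wienerOrliczSubalgebra h) : Circle → ℂ) = z • coeff (f : Circle → ℂ) :=
  funext fun n => coeff_smul z f n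

lemma coeff_coe_sub (f g : wienerOrliczSubalgebra h) :
    coeff ((f - g : wienerOrliczSubalgebra h) : Circle → ℂ) =
      coeff (f : Circle → ℂ) - coeff (g : Circle → ℂ) := by
  rw [sub_eq_add_neg, ← neg_one_smul ℂ g, coeff_coe_add, coeff_coe_smul, neg_one_smul,
    ← sub_eq_add_neg]

lemma coeff_coe_mul (f g : wienerOrliczSubalgebra h) :
    coeff ((f * g : wienerOrliczSubalgebra h) : Circle → ℂ) =
      conv (coeff (f : Circle → ℂ)) (coeff (g : Circle → ℂ)) :=
  funext fun n => coeff_mul (continuous_coe h f) (continuous_coe h g) (memCoeff_coe h f).summable n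

lemma isBanachAlgebraNorm_wienerOrlicz : IsBanachAlgebraNorm (wienerOrliczSubalgebra h)
    (fun f => wienerOrliczNorm Φ Ψ φ w ψ ρ (f : Circle → ℂ)) where
  nonneg f := coeffNorm_nonneg _
  eq_zero_iff f := by
    rw [wienerOrliczNorm_eq]
    constructor
    · intro h0
      have hs := (memCoeff_coe h f).summable
      have h1 : ∑' n, ‖coeff (f : Circle → ℂ) n‖ = 0 :=
        le_antisymm ((tsum_norm_le_coeffNorm _).trans h0.le) (tsum_nonneg fun _ => norm_nonneg _)
      have h2 : ∀ n, coeff (f : Circle → ℂ) n = 0 := fun n =>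
        norm_le_zero_iff.1 ((hs.le_tsum n fun _ _ => norm_nonneg _).trans h1.le)
      refine Subtype.ext (funext fun t => ?_)
      have h3 := hasSum_coeff_mul_zpow (continuous_coe h f) hs t
      simp only [h2, zero_mul] at h3
      exact h3.unique hasSum_zero
    · rintro rfl
      have := coeffNorm_smul h 0 (memCoeff_coe h 0)
      rwa [← coeff_coe_smul, smul_zero, norm_zero, zero_mul] at this
  smul z f := by
    rw [wienerOrliczNorm_eq, wienerOrliczNorm_eq, coeff_coe_smul,
      coeffNorm_smul h z (memCoeff_coe h f)]
  add_le f g := by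
    rw [wienerOrliczNorm_eq, coeff_coe_add]
    exact coeffNorm_add_le h (memCoeff_coe h f) (memCoeff_coe h g)
  mul_le := by
    obtain ⟨K, hK, hle⟩ := exists_coeffNorm_conv_le h
    refine ⟨2 * K, by positivity, fun f g => ?_⟩
    simp only [wienerOrliczNorm_eq, coeff_coe_mul]
    refine (hle _ _ (memCoeff_coe h f) (memCoeff_coe h g)).trans ?_
    have h1 := mul_le_mul_of_nonneg_right (tsum_norm_le_coeffNorm (Φ := Φ) (Ψ := Ψ) (φ := φ) (w := w)
      (ψ := ψ) (ρ := ρ) (coeff (g : Circle → ℂ))) (coeffNorm_nonneg (Φ := Φ) (Ψ := Ψ) (φ := φ)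
      (w := w) (ψ := ψ) (ρ := ρ) (coeff (f : Circle → ℂ)))
    have h2 := mul_le_mul_of_nonneg_right (tsum_norm_le_coeffNorm (Φ := Φ) (Ψ := Ψ) (φ := φ) (w := w)
      (ψ := ψ) (ρ := ρ) (coeff (f : Circle → ℂ))) (coeffNorm_nonneg (Φ := Φ) (Ψ := Ψ) (φ := φ)
      (w := w) (ψ := ψ) (ρ := ρ) (coeff (g : Circle → ℂ)))
    refine (mul_le_mul_of_nonneg_left (add_le_add h1 h2) hK.le).trans (le_of_eq ?_)
    ring
  complete u hu := by
    simp only [wienerOrliczNorm_eq, coeff_coe_sub] at hu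
    obtain ⟨d, hd, hlim⟩ := exists_coeffNorm_limit h (fun k => memCoeff_coe h (u k)) hu
    refine ⟨⟨synth d, synth_mem_wienerOrlicz hd⟩, ?_⟩
    simp only [wienerOrliczNorm_eq, coeff_coe_sub]
    rwa [funext (coeff_synth hd.summable)]

/-- The inequality for squares, with the ℓ¹ norm as the submultiplicative quantity, improves
continuity of characters from the full norm to the Wiener norm. -/
lemma norm_algHom_le_tsum (χ : wienerOrliczSubalgebra h →ₐ[ℂ] ℂ) (f : wienerOrliczSubalgebra h) :
    ‖χ f‖ ≤ ∑' n, ‖coeff (f : Circle → ℂ) n‖ := by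
  obtain ⟨K, hK, hle⟩ := exists_coeffNorm_conv_le h
  refine (isBanachAlgebraNorm_wienerOrlicz h).norm_algHom_le
    (W := fun f => ∑' n, ‖coeff (f : Circle → ℂ) n‖) (fun f => tsum_nonneg fun _ => norm_nonneg _)
    (fun f g => ?_) (K := 2 * K) (by positivity) (fun f => ?_) χ f
  · rw [coeff_coe_mul]
    exact tsum_norm_conv_le (memCoeff_coe h f).summable (memCoeff_coe h g).summable
  · simp only [wienerOrliczNorm_eq, coeff_coe_mul]
    exact (hle _ _ (memCoeff_coe h f) (memCoeff_coe h f)).trans (le_of_eq (by ring))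

/-- The monomial as an element of the algebra. -/
def monomialElem (n : ℤ) : wienerOrliczSubalgebra h :=
  ⟨monomial n, monomial_mem_wienerOrlicz h n⟩

lemma monomialElem_mul (m n : ℤ) :
    monomialElem h m * monomialElem h n = monomialElem h (m + n) :=
  Subtype.ext (congr_arg DFunLike.coe (monomial_mul m n))

lemma monomialElem_zero : monomialElem h 0 = 1 :=
  Subtype.ext (congr_arg DFunLike.coe monomial_zero)

lemma coeff_monomialElem (j : ℤ) :
    coeff (monomialElem h j : Circle → ℂ) = Pi.single j 1 := by
  ext n
  rw [Pi.single_apply]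
  exact coeff_monomial j n

lemma norm_algHom_monomialElem_le (χ : wienerOrliczSubalgebra h →ₐ[ℂ] ℂ) (n : ℤ) :
    ‖χ (monomialElem h n)‖ ≤ 1 := by
  refine (norm_algHom_le_tsum h χ _).trans (le_of_eq ?_)
  rw [coeff_monomialElem, tsum_eq_single n fun j hj => by simp [hj]]
  simp

/-- Every character is the evaluation at a point. -/
lemma exists_eq_evalAt (χ : wienerOrliczSubalgebra h →ₐ[ℂ] ℂ) :
    ∃ t : Circle, χ = evalAt (wienerOrliczSubalgebra h) t := by
  have hmul : ∀ m n, χ (monomialElem h m) * χ (monomialElem h n) = χ (monomialElem h (m + n)) :=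
    fun m n => by rw [← map_mul, monomialElem_mul]
  set z := χ (monomialElem h 1) with hz
  have hinv : ∀ n, χ (monomialElem h n) * χ (monomialElem h (-n)) = 1 := fun n => by
    rw [hmul, add_neg_cancel, monomialElem_zero, map_one]
  -- Both `z` and its inverse, the values of `χ` at `t` and `t⁻¹`, have modulus at most one.
  have hz1 : ‖z‖ = 1 := by
    have h1 := norm_algHom_monomialElem_le h χ 1
    have h2 := norm_algHom_monomialElem_le h χ (-1)
    have h3 := congr_arg norm (hinv 1)
    rw [norm_mul, norm_one, ← hz] at h3
    refine le_antisymm h1 ?_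
    calc 1 = ‖z‖ * ‖χ (monomialElem h (-1))‖ := h3.symm
      _ ≤ ‖z‖ := mul_le_of_le_one_right (norm_nonneg _) h2
  have hz0 : z ≠ 0 := norm_ne_zero_iff.1 (by rw [hz1]; exact one_ne_zero)
  have hzn : ∀ n : ℤ, χ (monomialElem h n) = z ^ n := by
    intro n
    induction n using Int.induction_on with
    | zero => rw [monomialElem_zero, map_one, zpow_zero]
    | succ n ih => rw [← hmul, ih, zpow_add_one₀ hz0]
    | pred n ih =>
      rw [sub_eq_add_neg, ← hmul, ih, zpow_add₀ hz0, zpow_neg_one]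
      congr 1
      exact eq_inv_of_mul_eq_one_right (hinv 1)
  let t : Circle := ⟨z, mem_sphere_zero_iff_norm.2 hz1⟩
  refine ⟨t, AlgHom.ext fun f => ?_⟩
  have hs := (memCoeff_coe h f).summable
  have h1 := hasSum_coeff_mul_zpow (continuous_coe h f) hs t
  refine HasSum.unique (f := fun n => coeff (f : Circle → ℂ) n * z ^ n) ?_ h1
  -- On a partial Fourier sum `χ` agrees with evaluation, and what remains is controlled by the ℓ¹
  -- tail.
  have h2 : ∀ s : Finset ℤ, ‖(∑ n ∈ s, coeff (f : Circle → ℂ) n * z ^ n) - χ f‖ ≤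
      ∑' n, ‖coeff (f : Circle → ℂ) n‖ - ∑ n ∈ s, ‖coeff (f : Circle → ℂ) n‖ := by
    intro s
    set p : wienerOrliczSubalgebra h := ∑ n ∈ s, coeff (f : Circle → ℂ) n • monomialElem h n with hp
    have h3 : χ p = ∑ n ∈ s, coeff (f : Circle → ℂ) n * z ^ n := by
      simp [hp, hzn]
    have h4 : ∀ n, coeff (p : Circle → ℂ) n = if n ∈ s then coeff (f : Circle → ℂ) n else 0 := by
      intro n
      have : coeff (p : Circle → ℂ) =
          ∑ j ∈ s, coeff (f : Circle → ℂ) j • (Pi.single j 1 : ℤ → ℂ) := by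
        rw [hp]
        induction s using Finset.induction_on with
        | empty =>
          have := coeff_coe_smul h 0 0
          rwa [zero_smul, zero_smul] at this
        | insert a s ha ih =>
          rw [Finset.sum_insert ha, Finset.sum_insert ha, coeff_coe_add, coeff_coe_smul,
            coeff_monomialElem, ih rfl (by simp [hzn])]
      rw [this]
      simp [Finset.sum_apply, Pi.single_apply]
    rw [← h3, ← map_sub]
    refine (norm_algHom_le_tsum h χ _).trans (le_of_eq ?_)
    rw [← hs.sum_add_tsum_compl (s := s), add_sub_cancel_left, coeff_coe_sub]
    refine Eq.trans ?_ (tsum_subtype (s : Set ℤ)ᶜ fun n => ‖coeff (f : Circle → ℂ) n‖).symm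
    refine tsum_congr fun n => ?_
    by_cases hn : n ∈ s <;> simp [h4, hn, Set.indicator]
  rw [HasSum, tendsto_iff_norm_sub_tendsto_zero]
  refine squeeze_zero (fun _ => norm_nonneg _) h2 ?_
  simpa using hs.hasSum.const_sub (∑' n, ‖coeff (f : Circle → ℂ) n‖)

lemma evalPoint_injective : Function.Injective (evalPoint (wienerOrliczSubalgebra h)) := by
  intro s t hst
  have := congr_arg (fun χ : wienerOrliczSubalgebra h →ₐ[ℂ] ℂ => χ (monomialElem h 1)) hst
  refine Circle.ext ?_
  simpa [evalPoint, evalAt, monomialElem] using this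

lemma continuous_evalPoint : Continuous (evalPoint (wienerOrliczSubalgebra h)) :=
  continuous_induced_rng.2 (continuous_pi fun f => continuous_coe h f)

/-- A continuous bijection from the compact circle onto a Hausdorff space is a homeomorphism. -/
lemma isHomeomorph_evalPoint : IsHomeomorph (evalPoint (wienerOrliczSubalgebra h)) := by
  have hinj : Function.Injective
      fun (χ : wienerOrliczSubalgebra h →ₐ[ℂ] ℂ) (f : wienerOrliczSubalgebra h) => χ f :=
    DFunLike.coe_injective
  have : T2Space (MaximalIdealSpace (wienerOrliczSubalgebra h)) :=
    T2Space.of_injective_continuous (X := MaximalIdealSpace _) hinj continuous_induced_dom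
  refine isHomeomorph_iff_continuous_bijective.2
    ⟨continuous_evalPoint h, evalPoint_injective h, fun χ => ?_⟩
  obtain ⟨t, ht⟩ := exists_eq_evalAt h χ
  exact ⟨t, ht.symm⟩

lemma isMaximal_iff (J : Ideal (wienerOrliczSubalgebra h)) :
    J.IsMaximal ↔ ∃! t : Circle, J = RingHom.ker (evalAt (wienerOrliczSubalgebra h) t) := by
  constructor
  · intro hJ
    obtain ⟨χ, hχ⟩ := (isBanachAlgebraNorm_wienerOrlicz h).exists_eq_ker J hJ
    obtain ⟨t, rfl⟩ := exists_eq_evalAt h χ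
    refine ⟨t, hχ, fun s hs => ?_⟩
    -- The coordinate function minus the constant `t` vanishes only at `t`, which gives uniqueness.
    have h1 : monomialElem h 1 - algebraMap ℂ _ (t : ℂ) ∈ J := by
      rw [hχ, RingHom.mem_ker]
      simp [evalAt, monomialElem]
    rw [hs, RingHom.mem_ker] at h1
    refine Circle.ext ?_
    simpa [evalAt, monomialElem, sub_eq_zero] using h1
  · rintro ⟨t, rfl, -⟩
    refine RingHom.ker_isMaximal_of_surjective _ fun z => ⟨algebraMap ℂ _ z, ?_⟩
    simp

end Subalgebra

/-! ### Exponentials and logarithms -/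

lemma exp_mem_wienerOrlicz (h : IsAdmissible Φ Ψ φ w ψ ρ) {f : Circle → ℂ}
    (hf : f ∈ wienerOrlicz Φ Ψ φ w ψ ρ) :
    (fun t => Complex.exp (f t)) ∈ wienerOrlicz Φ Ψ φ w ψ ρ := by
  obtain ⟨g, hg⟩ := (isBanachAlgebraNorm_wienerOrlicz h).exists_algHom_eq_exp ⟨f, hf⟩
  rw [show (fun t => Complex.exp (f t)) = g from funext fun t => (hg (evalAt _ t)).symm]
  exact g.2

/-- Since every character is an evaluation, a uniform bound on the circle is a bound on all
characters. -/
lemma exists_exp_eq_one_sub (h : IsAdmissible Φ Ψ φ w ψ ρ) {f : Circle → ℂ}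
    (hf : f ∈ wienerOrlicz Φ Ψ φ w ψ ρ) {q : ℝ} (hq : 0 ≤ q) (hq1 : q < 1)
    (hfq : ∀ t, ‖f t‖ ≤ q) :
    ∃ g ∈ wienerOrlicz Φ Ψ φ w ψ ρ, ∀ t, Complex.exp (g t) = 1 - f t := by
  obtain ⟨g, hg⟩ := (isBanachAlgebraNorm_wienerOrlicz h).exists_algHom_exp_eq (f := ⟨f, hf⟩) hq hq1
    fun χ => by
      obtain ⟨t, rfl⟩ := exists_eq_evalAt h χ
      exact hfq t
  exact ⟨g, g.2, fun t => hg (evalAt _ t)⟩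

lemma span_monomial_subset (h : IsAdmissible Φ Ψ φ w ψ ρ) {p : C(Circle, ℂ)}
    (hp : p ∈ Submodule.span ℂ (Set.range monomial)) : ⇑p ∈ wienerOrlicz Φ Ψ φ w ψ ρ := by
  have h0 : (0 : Circle → ℂ) ∈ wienerOrlicz Φ Ψ φ w ψ ρ := (wienerOrliczSubalgebra h).zero_mem
  induction hp using Submodule.span_induction with
  | mem p hp =>
    obtain ⟨n, rfl⟩ := hp
    exact monomial_mem_wienerOrlicz h n
  | zero => exact h0
  | add p q _ _ hp hq => exact wienerOrlicz_add h hp hq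
  | smul z p _ hp => exact wienerOrlicz_smul h z hp

/-- A non-vanishing continuous function of index zero has a continuous logarithm. -/
lemma HasCauchyIndex.exists_log {b : Circle → ℂ} (hb : Continuous b) (hb0 : ∀ t, b t ≠ 0)
    (hind : HasCauchyIndex b 0) : ∃ l : C(Circle, ℂ), IsLogOf l b := by
  obtain ⟨θ, hθ, hbθ, hper⟩ := hind
  set g : ℝ → ℂ := fun x => (Real.log ‖b (Circle.exp x)‖ : ℂ) + Complex.I * θ x with hg
  have hgc : Continuous g := by
    have : Continuous fun x => Real.log ‖b (Circle.exp x)‖ :=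
      Continuous.log (by fun_prop) fun x => norm_ne_zero_iff.2 (hb0 _)
    fun_prop
  -- Index zero is exactly what lets the logarithm close up around the circle.
  have hgper : g 0 = g (0 + 2 * Real.pi) := by
    have h1 : θ (2 * Real.pi) = θ 0 := by simpa [sub_eq_zero] using hper
    simp [hg, h1]
  have hgexp : ∀ x, Complex.exp (g x) = b (Circle.exp x) := by
    intro x
    rw [hg, Complex.exp_add, ← Complex.ofReal_exp,
      Real.exp_log (norm_pos_iff.2 (hb0 _)), ← hbθ]
  set G : AddCircle (2 * Real.pi) → ℂ := AddCircle.liftIco (2 * Real.pi) 0 g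
  have hG : Continuous G := AddCircle.liftIco_continuous hgper hgc.continuousOn
  refine ⟨⟨fun t => G (AddCircle.homeomorphCircle'.symm t), by fun_prop⟩, fun t => ?_⟩
  obtain ⟨x, hx, hxt⟩ := (AddCircle.coe_image_Ico_eq (2 * Real.pi) 0).ge
    (Set.mem_univ (AddCircle.homeomorphCircle'.symm t))
  change Complex.exp (G (AddCircle.homeomorphCircle'.symm t)) = b t
  have hGx : G x = g x := AddCircle.liftIco_coe_apply hx
  rw [← hxt, hGx, hgexp]
  congr 1
  rw [← AddCircle.homeomorphCircle'_apply_mk, hxt, Homeomorph.apply_symm_apply]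

lemma exists_log_mem_wienerOrlicz (h : IsAdmissible Φ Ψ φ w ψ ρ) {b : Circle → ℂ}
    (hb : b ∈ wienerOrlicz Φ Ψ φ w ψ ρ) (hb0 : ∀ t, b t ≠ 0) (hind : HasCauchyIndex b 0) :
    ∃ a ∈ wienerOrlicz Φ Ψ φ w ψ ρ, IsLogOf a b := by
  obtain ⟨l, hl⟩ := hind.exists_log hb.1 hb0
  obtain ⟨p, hp, hlp⟩ := exists_norm_sub_sum_lt l (ε := 1 / 4) (by norm_num)
  have hpm := span_monomial_subset h hp
  have hq := exp_mem_wienerOrlicz h (wienerOrlicz_smul h (-1) hpm)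
  have hone : (1 : Circle → ℂ) ∈ wienerOrlicz Φ Ψ φ w ψ ρ := (wienerOrliczSubalgebra h).one_mem
  -- The function is `1 - b e^(-p)`, which equals `1 - e^(l - p)`; membership is visible from the
  -- first form, smallness from the second.
  have hf := wienerOrlicz_add h hone (wienerOrlicz_smul h (-1) (wienerOrlicz_mul h hb hq))
  have hfe : ∀ t, (1 : Circle → ℂ) t + ((-1 : ℂ) • (b * fun t => Complex.exp (((-1 : ℂ) • ⇑p) t))) t =
      1 - Complex.exp (l t - p t) := by
    intro t
    simp only [Pi.one_apply, Pi.smul_apply, Pi.mul_apply, smul_eq_mul, ← hl t, ← Complex.exp_add]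
    ring_nf
  obtain ⟨g, hg, hgexp⟩ := exists_exp_eq_one_sub h hf (q := 1 / 2) (by norm_num) (by norm_num)
    fun t => by
      have h1 : ‖l t - p t‖ ≤ 1 / 4 := ((l - p).norm_coe_le_norm t).trans hlp.le
      -- The bound `|e^u - 1| ≤ 2|u|` for `|u| ≤ 1` turns `1/4` into `1/2`.
      have h2 := Complex.norm_exp_sub_one_le (h1.trans (by norm_num))
      rw [Pi.add_apply, hfe, norm_sub_rev]
      linarith
  refine ⟨g + p, wienerOrlicz_add h hg hpm, fun t => ?_⟩
  rw [Pi.add_apply, Complex.exp_add, hgexp, Pi.add_apply, hfe, sub_sub_cancel, ← Complex.exp_add,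
    sub_add_cancel, hl]

/-! ### Factorization -/

/-- Restriction of the Fourier series to the frequencies in the range of `e`. -/
lemma exists_tsum_mem_wienerOrlicz (h : IsAdmissible Φ Ψ φ w ψ ρ) {a : Circle → ℂ}
    (ha : a ∈ wienerOrlicz Φ Ψ φ w ψ ρ) {e : ℕ+ → ℤ} (he : Function.Injective e) :
    (fun t : Circle => ∑' n, coeff a (e n) * (t : ℂ) ^ e n) ∈ wienerOrlicz Φ Ψ φ w ψ ρ := by
  have hc : MemCoeff Φ Ψ φ w ψ ρ ((Set.range e).indicator (coeff a)) :=
    (mem_wienerOrlicz_iff.1 ha).2.of_norm_le h fun n => norm_indicator_le_norm_self _ _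
  convert synth_mem_wienerOrlicz hc using 1
  ext t
  have h1 := synth_apply hc.summable t
  rw [← he.hasSum_iff fun n hn => by simp [Set.indicator_of_notMem hn]] at h1
  rw [← h1.tsum_eq]
  simp

lemma inv_exp_mem_wienerOrlicz (h : IsAdmissible Φ Ψ φ w ψ ρ) {f : Circle → ℂ}
    (hf : f ∈ wienerOrlicz Φ Ψ φ w ψ ρ) :
    (fun t => Complex.exp (f t))⁻¹ ∈ wienerOrlicz Φ Ψ φ w ψ ρ := by
  convert exp_mem_wienerOrlicz h (wienerOrlicz_smul h (-1) hf) using 1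
  ext t
  simp [Complex.exp_neg]

lemma summable_coeff_mul_zpow {a : Circle → ℂ} (ha : a ∈ wienerOrlicz Φ Ψ φ w ψ ρ) {e : ℕ+ → ℤ}
    (he : Function.Injective e) (t : Circle) :
    Summable fun n => coeff a (e n) * (t : ℂ) ^ e n :=
  (hasSum_coeff_mul_zpow ha.1 ha.2.1 t).summable.comp_injective he

/-- Exponentiate the Fourier series of the logarithm, split into zero, negative and positive
frequencies. -/
lemma IsLogOf.eq_geomMean_mul {a b : Circle → ℂ} (ha : a ∈ wienerOrlicz Φ Ψ φ w ψ ρ)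
    (hab : IsLogOf a b) (t : Circle) : b t = geomMean a * factorMinus a t * factorPlus a t := by
  have h1 := hasSum_coeff_mul_zpow ha.1 ha.2.1 t
  have key : a t = coeff a 0 + ∑' n : ℕ+, coeff a (-(n : ℤ)) * (t : ℂ) ^ (-(n : ℤ)) +
      ∑' n : ℕ+, coeff a (n : ℤ) * (t : ℂ) ^ (n : ℤ) := by
    rw [← h1.tsum_eq, tsum_int_eq_zero_add_tsum_pnat h1.summable, zpow_zero, mul_one,
      add_right_comm]
  rw [← hab t, key, Complex.exp_add, Complex.exp_add]
  rfl

end OrliczWiener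

end

theorem corollary2p3 (Φ Ψ : ℝ → ℝ) (φ w : ℕ+ → ℝ) (ψ ρ : ℕ → ℝ)
    (hΦ : OrliczWiener.IsOrliczFunction Φ) (hΨ : OrliczWiener.IsOrliczFunction Ψ)
    (hφ : OrliczWiener.IsWeightMinus φ) (hw : OrliczWiener.IsWeightMinus w)
    (hψ : OrliczWiener.IsWeightPlus ψ) (hρ : OrliczWiener.IsWeightPlus ρ) :
    -- (a)
    (∃ A : Subalgebra ℂ (Circle → ℂ),
      (A : Set (Circle → ℂ)) = OrliczWiener.wienerOrlicz Φ Ψ φ w ψ ρ ∧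
      OrliczWiener.IsBanachAlgebraNorm A
        (fun f : A => OrliczWiener.wienerOrliczNorm Φ Ψ φ w ψ ρ (f : Circle → ℂ)) ∧
      IsHomeomorph (OrliczWiener.evalPoint A) ∧
      ∀ J : Ideal A, J.IsMaximal ↔ ∃! t : Circle, J = RingHom.ker (OrliczWiener.evalAt A t)) ∧
    -- (b) and (c)
    (∀ b ∈ OrliczWiener.wienerOrlicz Φ Ψ φ w ψ ρ,
      (∀ t, b t ≠ 0) → OrliczWiener.HasCauchyIndex b 0 →
      (∃ a ∈ OrliczWiener.wienerOrlicz Φ Ψ φ w ψ ρ, OrliczWiener.IsLogOf a b) ∧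
      ∀ a ∈ OrliczWiener.wienerOrlicz Φ Ψ φ w ψ ρ, OrliczWiener.IsLogOf a b →
        (∀ t : Circle,
          Summable (fun n : ℕ+ => OrliczWiener.coeff a (n : ℤ) * (t : ℂ) ^ (n : ℤ)) ∧
          Summable (fun n : ℕ+ => OrliczWiener.coeff a (-(n : ℤ)) * (t : ℂ) ^ (-(n : ℤ))) ∧
          b t = OrliczWiener.geomMean a * OrliczWiener.factorMinus a t *
            OrliczWiener.factorPlus a t) ∧
        OrliczWiener.factorPlus a ∈ OrliczWiener.wienerOrlicz Φ Ψ φ w ψ ρ ∧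
        (OrliczWiener.factorPlus a)⁻¹ ∈ OrliczWiener.wienerOrlicz Φ Ψ φ w ψ ρ ∧
        OrliczWiener.factorMinus a ∈ OrliczWiener.wienerOrlicz Φ Ψ φ w ψ ρ ∧
        (OrliczWiener.factorMinus a)⁻¹ ∈ OrliczWiener.wienerOrlicz Φ Ψ φ w ψ ρ) := by
  have h : OrliczWiener.IsAdmissible Φ Ψ φ w ψ ρ := ⟨hΦ, hΨ, hφ, hw, hψ, hρ⟩
  have hpos : Function.Injective fun n : ℕ+ => (n : ℤ) :=
    Nat.cast_injective.comp PNat.coe_injective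
  refine ⟨⟨OrliczWiener.wienerOrliczSubalgebra h, rfl,
    OrliczWiener.isBanachAlgebraNorm_wienerOrlicz h, OrliczWiener.isHomeomorph_evalPoint h,
    OrliczWiener.isMaximal_iff h⟩, fun b hb hb0 hind =>
    ⟨OrliczWiener.exists_log_mem_wienerOrlicz h hb hb0 hind, fun a ha hab => ?_⟩⟩
  have hplus := OrliczWiener.exists_tsum_mem_wienerOrlicz h ha hpos
  have hminus := OrliczWiener.exists_tsum_mem_wienerOrlicz h ha OrliczWiener.neg_pnat_injective
  exact ⟨fun t => ⟨OrliczWiener.summable_coeff_mul_zpow ha hpos t,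
      OrliczWiener.summable_coeff_mul_zpow ha OrliczWiener.neg_pnat_injective t,
      hab.eq_geomMean_mul ha t⟩,
    OrliczWiener.exp_mem_wienerOrlicz h hplus, OrliczWiener.inv_exp_mem_wienerOrlicz h hplus,
    OrliczWiener.exp_mem_wienerOrlicz h hminus, OrliczWiener.inv_exp_mem_wienerOrlicz h hminus⟩
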